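/- There is a universal constant $C_0>0$ with the following property. Let $K\ge 2$, $p\ge 1$ and $N>K$. Let $\pi_1,\dots,\pi_K>0$ with $\sum_k\pi_k=1$, let $\mu_1,\dots,\mu_K\in\mathbb R^p$, and let $\Sigma\in\mathbb R^{p\times p}$ be symmetric positive definite. Let $(X_1,Y_1),\dots,(X_N,Y_N)$ be i.i.d. with $\mathbb P(Y_i=k)=\pi_k$ and $X_i\mid Y_i=k\sim\mathcal N(\mu_k,\Sigma)$. Put $K'=K-1$. For $1\le k\le K'$ put $\delta_k=\mu_1-\mu_{k+1}$, $\beta_k=\Sigma^{-1}\delta_k=(\beta_k^1,\dots,\beta_k^p)$ and $\Delta=\sum_{k=1}^{K'}\langle\Sigma^{-1}\delta_k,\delta_k\rangle$. Put $\beta^j=(\beta^j_1,\dots,\beta^j_{K'})$ for $1\le j\le p$, $T=\{j:\beta^j\ne0\}$, $\Sigma^+_{\max}=\max_j\Sigma_{jj}$ and $$\bar\pi=\max_{2\le k\le K}\frac{\pi_1+\pi_k}{\pi_1\pi_k}.$$ Let $n_k=\#\{i:Y_i=k\}$, $\hat\mu_k=n_k^{-1}\sum_{Y_i=k}X_i$,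 $\hat\delta_k=\hat\mu_1-\hat\mu_{k+1}$, $S=(N-K)^{-1}\sum_{k=1}^K\sum_{Y_i=k}(X_i-\hat\mu_k)(X_i-\hat\mu_k)'$, and let $\mathcal A$ be the event that $n_k\in[N\pi_k/2,\,3N\pi_k/2]$ for all $1\le k\le K$. Write $\|\cdot\|$ for the Euclidean norm and $a\vee b=\max(a,b)$. For every $t>0$ there is an event $\mathcal B_t$ with $$\mathbb P(\mathcal B_t)\ \ge\ \mathbb P(\mathcal A)-Kp\,e^{-t}-\frac{2Kp}{\sqrt\pi\,t}\,e^{-t^2}$$ (here $\pi=3.14\ldots$) on which $n_k\ge1$ for all $k$ and the following holds for all $\lambda_1,\dots,\lambda_p>0$ and every minimizer $(\hat\beta_1,\dots,\hat\beta_{K'})$ of $$\sum_{k=1}^{K'}\tfrac12 b_k'Sb_k-\sum_{k=1}^{K'}\hat\delta_k'b_k+\sum_{j=1}^p\lambda_j\|b^j\|$$ over $b_1,\dots,b_{K'}\in\mathbb R^p$, where $b^j=(b^j_1,\dots,b^j_{K'})$. Let $$\lambda^*=2C_0\sqrt{\frac{\bar\pi\,\Sigma^+_{\max}(\Delta\vee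 K)\,t}{N-K}}.$$ (i) If $t\le N-K$, or if $\lambda_j=\lambda^*$ for all $j$, then $$\sum_{j=1}^p\lambda_j\|\hat\beta^j\|\ \le\ \sum_{j=1}^p\lambda_j\|\beta^j\|+C_0\sum_{j=1}^p\|\hat\beta^j-\beta^j\|\sqrt{\frac{\bar\pi\,\Sigma_{jj}(\Delta\vee K)\,t}{N-K}} .$$ (ii) If $\lambda_j=\lambda^*$ for all $j$, then $$\sum_{j\notin T}\|\hat\beta^j\|\ \le\ 3\sum_{j\in T}\|\hat\beta^j-\beta^j\| .$$ -/

import Mathlib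

open MeasureTheory ProbabilityTheory Matrix

namespace SparseLDA

noncomputable section

/- Conventions: there are `K = m + 1` classes, indexed by `Fin (m + 1)`; class `1` of the
mathematical text is the index `0`, and class `k + 1` is the index `k.succ` for `k : Fin m`.
So `m = K - 1 = K'`. A family `β_1, …, β_{K'}` of vectors in `ℝ^p` is stored as the `p × K'` matrix
with these columns; its rows are the vectors `β^1, …, β^p ∈ ℝ^{K'}`. -/

variable {p m N : ℕ}

/-! ### Population quantities -/

/-- The mean difference `δ_k = μ_1 - μ_{k+1}`. -/
def meanDiff (mu : Fin (m + 1) → EuclideanSpace ℝ (Fin p)) (k : Fin m) : Fin p → ℝ :=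
  fun j => mu 0 j - mu k.succ j

/-- The Bayes directions `β_k = Σ⁻¹ δ_k`, as the columns of a `p × K'` matrix. -/
def bayesDir (mu : Fin (m + 1) → EuclideanSpace ℝ (Fin p)) (Sig : Matrix (Fin p) (Fin p) ℝ) :
    Matrix (Fin p) (Fin m) ℝ :=
  Matrix.of fun j k => (Sig⁻¹ *ᵥ meanDiff mu k) j

/-- `Δ = ∑_k ⟨Σ⁻¹ δ_k, δ_k⟩`. -/
def totalDelta (mu : Fin (m + 1) → EuclideanSpace ℝ (Fin p)) (Sig : Matrix (Fin p) (Fin p) ℝ) :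
    ℝ :=
  ∑ k : Fin m, (Sig⁻¹ *ᵥ meanDiff mu k) ⬝ᵥ meanDiff mu k

/-- `π̄ = max_{2 ≤ k ≤ K} (π_1 + π_k) / (π_1 π_k)`. -/
def piBar (prior : Fin (m + 1) → ℝ) : ℝ :=
  ⨆ k : Fin m, (prior 0 + prior k.succ) / (prior 0 * prior k.succ)

/-- `A⁺_max = max_j A_jj`. -/
def diagMax (A : Matrix (Fin p) (Fin p) ℝ) : ℝ :=
  ⨆ j : Fin p, A j j

/-- `√(π̄ v (Δ ∨ K) t / (N - K))`, to be used with `v = Σ_jj` and with `v = Σ⁺_max`. -/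
def rate (N : ℕ) (prior : Fin (m + 1) → ℝ) (mu : Fin (m + 1) → EuclideanSpace ℝ (Fin p))
    (Sig : Matrix (Fin p) (Fin p) ℝ) (t v : ℝ) : ℝ :=
  Real.sqrt (piBar prior * v * max (totalDelta mu Sig) (m + 1 : ℕ) * t / ((N : ℝ) - (m + 1 : ℕ)))

/-- The Euclidean norm `‖β^j‖` of the `j`-th row. -/
def rowNorm (b : Matrix (Fin p) (Fin m) ℝ) (j : Fin p) : ℝ :=
  ‖(WithLp.toLp 2 (b j) : EuclideanSpace ℝ (Fin m))‖

open Classical in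
/-- The union over `k` of the supports of the columns `β_k`. -/
def jointSupport (b : Matrix (Fin p) (Fin m) ℝ) : Finset (Fin p) :=
  {j | ∃ k, b j k ≠ 0}

/-! ### Sample quantities, for data `(x_1, y_1), …, (x_N, y_N)` -/

/-- The class count `n_k`. -/
def classCount (y : Fin N → Fin (m + 1)) (k : Fin (m + 1)) : ℕ :=
  Finset.card {i | y i = k}

/-- The class mean `μ̂_k`. -/
def classMean (x : Fin N → EuclideanSpace ℝ (Fin p)) (y : Fin N → Fin (m + 1))
    (k : Fin (m + 1)) : Fin p → ℝ :=
  fun j => (classCount y k : ℝ)⁻¹ * ∑ i with y i = k, x i j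

/-- The pooled sample covariance
`S = (N - K)⁻¹ ∑_k ∑_{i : y_i = k} (x_i - μ̂_k) (x_i - μ̂_k)'`. -/
def pooledCov (x : Fin N → EuclideanSpace ℝ (Fin p)) (y : Fin N → Fin (m + 1)) :
    Matrix (Fin p) (Fin p) ℝ :=
  Matrix.of fun a b => ((N : ℝ) - (m + 1 : ℕ))⁻¹ *
    ∑ k : Fin (m + 1), ∑ i with y i = k, (x i a - classMean x y k a) * (x i b - classMean x y k b)

/-- `δ̂_k = μ̂_1 - μ̂_{k+1}`. -/
def meanDiffHat (x : Fin N → EuclideanSpace ℝ (Fin p)) (y : Fin N → Fin (m + 1))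
    (k : Fin m) : Fin p → ℝ :=
  fun j => classMean x y 0 j - classMean x y k.succ j

/-- The objective
`∑_k ½ b_k' S b_k - ∑_k δ̂_k' b_k + ∑_j λ_j ‖b^j‖` (here `bᵀ k` is the column `b_k`). -/
def objective (x : Fin N → EuclideanSpace ℝ (Fin p)) (y : Fin N → Fin (m + 1))
    (lam : Fin p → ℝ) (b : Matrix (Fin p) (Fin m) ℝ) : ℝ :=
  ∑ k : Fin m, (1 / 2 : ℝ) * (bᵀ k ⬝ᵥ pooledCov x y *ᵥ bᵀ k)
    - ∑ k : Fin m, meanDiffHat x y k ⬝ᵥ bᵀ k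
    + ∑ j : Fin p, lam j * rowNorm b j

/-- `b` is a solution `(β̂_1, …, β̂_{K'})` of the penalized minimization problem. -/
def IsEstimator (x : Fin N → EuclideanSpace ℝ (Fin p)) (y : Fin N → Fin (m + 1))
    (lam : Fin p → ℝ) (b : Matrix (Fin p) (Fin m) ℝ) : Prop :=
  ∀ b' : Matrix (Fin p) (Fin m) ℝ, objective x y lam b ≤ objective x y lam b'

/-! ### The random sample -/

/-- `(X_1, Y_1), …, (X_N, Y_N)` are i.i.d. with `ℙ(Y = k) = π_k` and `X | Y = k ∼ 𝒩(μ_k, Σ)`. -/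
structure IsLDASample {Ω : Type*} [MeasurableSpace Ω] (P : Measure Ω)
    (X : Fin N → Ω → EuclideanSpace ℝ (Fin p)) (Y : Fin N → Ω → Fin (m + 1))
    (prior : Fin (m + 1) → ℝ) (mu : Fin (m + 1) → EuclideanSpace ℝ (Fin p))
    (Sig : Matrix (Fin p) (Fin p) ℝ) : Prop where
  measurable_X : ∀ i, Measurable (X i)
  measurable_Y : ∀ i, Measurable (Y i)
  indep : iIndepFun (fun i ω => (X i ω, Y i ω)) P
  label_law : ∀ i k, P.real (Y i ⁻¹' {k}) = prior k
  cond_law : ∀ i k, (cond P (Y i ⁻¹' {k})).map (X i) = multivariateGaussian (mu k) Sig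

/-- The event `𝒜` that `n_k ∈ [N π_k / 2, 3 N π_k / 2]` for all classes `k`. -/
def balancedEvent {Ω : Type*} (Y : Fin N → Ω → Fin (m + 1)) (prior : Fin (m + 1) → ℝ) : Set Ω :=
  {ω | ∀ k, (classCount (fun i => Y i ω) k : ℝ) ∈
    Set.Icc ((N : ℝ) * prior k / 2) (3 * (N : ℝ) * prior k / 2)}

end

end SparseLDA

namespace SparseLDA

/-! ### Gaussian tail bounds -/

/-! The smooth part of the objective is convex because `S` is positive semidefinite. Comparing a
minimizer with any `b` therefore costs only the gradient of the smooth part at `b`, paired row by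
row with `β̂ - b` (`basic_inequality`). At the Bayes directions this gradient is `(S - Σ) β_k -
(δ̂_k - δ_k)`, pure noise because `Σ β_k = δ_k`. Statement (i) thus follows once each row of this
matrix is bounded by `C₀` times the rate, and (ii) follows from (i) by the usual cone argument,
since `λ*` is twice the largest noise level.

For fixed labels the centred scores in a direction `v` are a standard Gaussian vector of `ℝ^N` times
`√(v'Σv)` (`map_score`). The mean noise is then a linear form in such a vector (`mean_noise_tail`).
An entry of `S β_k` is a bilinear form in two of them through a projection of rank `N - K`;
polarization reduces it to centred chi-square variables (`cross_score_tail`). Summing squares over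
`k` produces `K` from the means and `Δ` from the covariance, whence the factor `Δ ∨ K`. Averaging
over balanced labels (`prob_of_designLaw_le`) makes the bounds unconditional.

The chi-square bound has the needed form only for `t ≤ N - K`. For larger `t` and `λ = λ*`, the
population differences `δ_k` are themselves below the rate, so the penalty dominates the gradient at
`0`; hence `β̂ = 0` and both claims are trivial. -/

/-- Equivalent to `1 ≤ (1 - x) e^{x + x²}`: the quadratic lower bound for the exponential suffices
for `x ≥ 0`, the linear one for `x ≤ 0`. With `x = 2θ` it controls the chi-square Laplace transform.
-/
lemma exp_neg_sub_sq_le {x : ℝ} (hx : |x| ≤ 1 / 2) : Real.exp (-x - x ^ 2) ≤ 1 - x := by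
  obtain ⟨h1, h2⟩ := abs_le.1 hx
  have hpos : 0 < 1 - x := by linarith
  have key : 1 ≤ (1 - x) * Real.exp (x + x ^ 2) := by
    rcases le_total 0 x with h | h
    · have hq := Real.quadratic_le_exp_of_nonneg (x := x + x ^ 2) (by positivity)
      have : 1 ≤ (1 - x) * (1 + (x + x ^ 2) + (x + x ^ 2) ^ 2 / 2) := by
        have h3 : 0 ≤ x ^ 2 * (1 - x - x ^ 2 - x ^ 3) := by
          apply mul_nonneg (sq_nonneg x)
          nlinarith [mul_nonneg h h, mul_nonneg h (mul_nonneg h h)]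
        nlinarith
      exact this.trans (mul_le_mul_of_nonneg_left hq hpos.le)
    · have hq := Real.add_one_le_exp (x + x ^ 2)
      have : 1 ≤ (1 - x) * (x + x ^ 2 + 1) := by
        nlinarith [mul_nonneg (neg_nonneg.2 h) (sq_nonneg x)]
      exact this.trans (mul_le_mul_of_nonneg_left hq hpos.le)
  rw [show -x - x ^ 2 = -(x + x ^ 2) by ring, Real.exp_neg, inv_le_iff_one_le_mul₀ (Real.exp_pos _)]
  exact key

lemma gaussianPDFReal_smul_exp_sq (θ x : ℝ) :
    gaussianPDFReal 0 1 x • Real.exp (θ * (x ^ 2 - 1)) =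
      (√(2 * Real.pi))⁻¹ * Real.exp (-θ) * Real.exp (-(1 / 2 - θ) * x ^ 2) := by
  simp only [gaussianPDFReal, smul_eq_mul, NNReal.coe_one, mul_one, sub_zero]
  rw [mul_assoc, mul_assoc, ← Real.exp_add, ← Real.exp_add]
  congr 2
  ring

lemma integrable_exp_sq_gaussianReal {θ : ℝ} (hθ : θ < 1 / 2) :
    Integrable (fun x => Real.exp (θ * (x ^ 2 - 1))) (gaussianReal 0 1) := by
  rw [gaussianReal_of_var_ne_zero _ one_ne_zero,
    integrable_withDensity_iff_integrable_smul' (by fun_prop)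
      (by simp [gaussianPDF])]
  simp_rw [gaussianPDF, ENNReal.toReal_ofReal (gaussianPDFReal_nonneg _ _ _),
    gaussianPDFReal_smul_exp_sq]
  exact (integrable_exp_neg_mul_sq (by linarith)).const_mul _

lemma integral_exp_sq_gaussianReal_le {θ : ℝ} (hθ : |θ| ≤ 1 / 4) :
    ∫ x, Real.exp (θ * (x ^ 2 - 1)) ∂(gaussianReal 0 1) ≤ Real.exp (2 * θ ^ 2) := by
  obtain ⟨h1, h2⟩ := abs_le.1 hθ
  rw [integral_gaussianReal_eq_integral_smul one_ne_zero]
  simp_rw [gaussianPDFReal_smul_exp_sq]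
  rw [integral_const_mul, integral_gaussian]
  have hb : (0 : ℝ) < 1 - 2 * θ := by linarith
  have e1 : √(Real.pi / (1 / 2 - θ)) = √(2 * Real.pi) / √(1 - 2 * θ) := by
    rw [← Real.sqrt_div (by positivity)]
    congr 1
    rw [div_eq_div_iff (by linarith) (by linarith)]
    ring
  have hp : (√(2 * Real.pi)) ≠ 0 := by positivity
  rw [e1]
  -- The integral equals `e^{-θ} / √(1 - 2θ)`; this is the lower bound needed for its denominator.
  have hs : Real.exp (-θ - 2 * θ ^ 2) ≤ √(1 - 2 * θ) := by
    apply Real.le_sqrt_of_sq_le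
    have := exp_neg_sub_sq_le (x := 2 * θ) (by rw [abs_mul]; norm_num; linarith)
    rw [← Real.exp_nat_mul]
    convert this using 2
    push_cast; ring
  have hs' : 0 < √(1 - 2 * θ) := Real.sqrt_pos.2 hb
  calc (√(2 * Real.pi))⁻¹ * Real.exp (-θ) * (√(2 * Real.pi) / √(1 - 2 * θ))
      = Real.exp (-θ) / √(1 - 2 * θ) := by field_simp
    _ ≤ Real.exp (2 * θ ^ 2) := by
        rw [div_le_iff₀ hs']
        calc Real.exp (-θ) = Real.exp (2 * θ ^ 2) * Real.exp (-θ - 2 * θ ^ 2) := by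
              rw [← Real.exp_add]; congr 1; ring
          _ ≤ _ := by gcongr

variable {ι : Type*} [Fintype ι]

/-- The Laplace transform of a centred quadratic form `∑ lᵢ (gᵢ² - 1)` with `lᵢ ∈ {0, 1}`. -/
lemma mgf_sum_sq_le {l : ι → ℝ} (hl : ∀ i, l i = 0 ∨ l i = 1) {θ : ℝ} (hθ : |θ| ≤ 1 / 4) :
    Integrable (fun g : ι → ℝ => Real.exp (θ * ∑ i, l i * (g i ^ 2 - 1)))
        (Measure.pi fun _ => gaussianReal 0 1) ∧
      mgf (fun g : ι → ℝ => ∑ i, l i * (g i ^ 2 - 1)) (Measure.pi fun _ => gaussianReal 0 1) θ ≤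
        Real.exp (2 * θ ^ 2 * ∑ i, l i) := by
  have hθi : ∀ i, |θ * l i| ≤ 1 / 4 := fun i => by
    rcases hl i with h | h
    · simp [h]
    · simpa [h] using hθ
  have e : (fun g : ι → ℝ => Real.exp (θ * ∑ i, l i * (g i ^ 2 - 1))) =
      fun g : ι → ℝ => ∏ i, Real.exp ((θ * l i) * (g i ^ 2 - 1)) := by
    funext g
    rw [← Real.exp_sum, Finset.mul_sum]
    simp_rw [mul_assoc]
  constructor
  · rw [e]
    exact Integrable.fintype_prod
      (f := fun i x => Real.exp ((θ * l i) * (x ^ 2 - 1))) fun i =>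
        integrable_exp_sq_gaussianReal (by have := (abs_le.1 (hθi i)).2; linarith)
  · rw [mgf, e, integral_fintype_prod_eq_prod (f := fun i x => Real.exp ((θ * l i) * (x ^ 2 - 1))),
      Finset.mul_sum, Real.exp_sum]
    refine Finset.prod_le_prod (fun i _ => integral_nonneg fun _ => (Real.exp_pos _).le) fun i _ => ?_
    refine (integral_exp_sq_gaussianReal_le (hθi i)).trans (Real.exp_le_exp.2 ?_)
    rcases hl i with h | h <;> simp [h]

/-- Chernoff's method on both sides. The condition `t ≤ d` keeps the optimizing parameter within the
range where the Laplace transform is sub-Gaussian. -/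
lemma sum_sq_tail {l : ι → ℝ} (hl : ∀ i, l i = 0 ∨ l i = 1) {d t : ℝ} (hd : ∑ i, l i = d)
    (ht : 0 < t) (htd : t ≤ d) :
    (Measure.pi fun _ : ι => gaussianReal 0 1).real
        {g | 25 / 2 * √(d * t) < |∑ i, l i * g i ^ 2 - d|} ≤ 2 * Real.exp (-3 * t) := by
  set Q := Measure.pi fun _ : ι => gaussianReal 0 1
  set Z : (ι → ℝ) → ℝ := fun g => ∑ i, l i * (g i ^ 2 - 1)
  have hdpos : 0 < d := ht.trans_le htd
  -- With this choice the Chernoff exponent is `-(25/2)(t/4) + 2(t/16) = -3t`, which explains the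
  -- constant `25/2`.
  set θ := √(t / d) / 4 with hθ
  have hθ0 : 0 ≤ θ := by positivity
  have hθ1 : θ ≤ 1 / 4 := by
    have : √(t / d) ≤ 1 := Real.sqrt_le_one.2 ((div_le_one hdpos).2 htd)
    linarith
  have hprod : θ * √(d * t) = t / 4 := by
    rw [hθ, div_mul_eq_mul_div, ← Real.sqrt_mul (by positivity),
      show t / d * (d * t) = t ^ 2 by field_simp, Real.sqrt_sq ht.le]
  have hsq : θ ^ 2 * d = t / 16 := by
    rw [hθ, div_pow, Real.sq_sqrt (by positivity)]; field_simp; norm_num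
  have hZ : ∀ g, Z g = ∑ i, l i * g i ^ 2 - d := fun g => by
    simp only [Z, mul_sub, mul_one, Finset.sum_sub_distrib, hd]
  have hup : Q.real {g | 25 / 2 * √(d * t) ≤ Z g} ≤ Real.exp (-3 * t) := by
    obtain ⟨hi, hm⟩ := mgf_sum_sq_le hl (θ := θ) (by rwa [abs_of_nonneg hθ0])
    refine (measure_ge_le_exp_mul_mgf _ hθ0 hi).trans
      ((mul_le_mul_of_nonneg_left hm (Real.exp_pos _).le).trans ?_)
    rw [← Real.exp_add, hd]
    apply Real.exp_le_exp.2
    nlinarith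
  have hlo : Q.real {g | Z g ≤ -(25 / 2 * √(d * t))} ≤ Real.exp (-3 * t) := by
    obtain ⟨hi, hm⟩ := mgf_sum_sq_le hl (θ := -θ) (by rwa [abs_neg, abs_of_nonneg hθ0])
    refine (measure_le_le_exp_mul_mgf _ (neg_nonpos.2 hθ0) hi).trans
      ((mul_le_mul_of_nonneg_left hm (Real.exp_pos _).le).trans ?_)
    rw [← Real.exp_add, hd]
    apply Real.exp_le_exp.2
    nlinarith
  calc _ ≤ Q.real ({g | 25 / 2 * √(d * t) ≤ Z g} ∪ {g | Z g ≤ -(25 / 2 * √(d * t))}) := by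
        apply measureReal_mono _ (measure_ne_top _ _)
        intro g hg
        simp only [Set.mem_ofPred_eq, ← hZ, lt_abs] at hg
        rcases hg with h | h
        · exact Or.inl h.le
        · exact Or.inr (by simp only [Set.mem_ofPred_eq]; linarith)
    _ ≤ _ := (measureReal_union_le _ _).trans (by linarith)

/-- Concentration of `gᵀ M g` for an orthogonal projection matrix `M` of trace `d`. -/
lemma projection_form_tail [DecidableEq ι] {M : Matrix ι ι ℝ} (hM : M.IsHermitian)
    (hMM : M * M = M) {d t : ℝ} (hd : M.trace = d) (ht : 0 < t) (htd : t ≤ d) :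
    (stdGaussian (EuclideanSpace ℝ ι)).real
        {w | 25 / 2 * √(d * t) < |w.ofLp ⬝ᵥ M *ᵥ w.ofLp - d|} ≤ 2 * Real.exp (-3 * t) := by
  have hl : ∀ i, hM.eigenvalues i = 0 ∨ hM.eigenvalues i = 1 := by
    intro i
    have h1 := hM.mulVec_eigenvectorBasis i
    have h2 : M *ᵥ (M *ᵥ (hM.eigenvectorBasis i).ofLp) = M *ᵥ (hM.eigenvectorBasis i).ofLp := by
      rw [mulVec_mulVec, hMM]
    simp only [h1, mulVec_smul] at h2
    have hne : (hM.eigenvectorBasis i).ofLp ≠ 0 := by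
      intro h
      have := hM.eigenvectorBasis.orthonormal.1 i
      rw [show hM.eigenvectorBasis i = 0 from by ext j; exact congrFun h j] at this
      simp at this
    rw [← sub_eq_zero, smul_smul, ← sub_smul, smul_eq_zero, or_iff_left hne] at h2
    have : hM.eigenvalues i * (hM.eigenvalues i - 1) = 0 := by linarith
    rcases mul_eq_zero.1 this with h | h
    · exact Or.inl h
    · exact Or.inr (by linarith)
  have hsum : ∑ i, hM.eigenvalues i = d := by
    rw [← hd, hM.trace_eq_sum_eigenvalues]; simp
  have hform : ∀ x : ι → ℝ, ((∑ i, x i • hM.eigenvectorBasis i : EuclideanSpace ℝ ι)).ofLp ⬝ᵥ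
      M *ᵥ (∑ i, x i • hM.eigenvectorBasis i : EuclideanSpace ℝ ι).ofLp =
      ∑ i, hM.eigenvalues i * x i ^ 2 := by
    intro x
    have e : (WithLp.toLp 2 (M *ᵥ (∑ i, x i • hM.eigenvectorBasis i : EuclideanSpace ℝ ι).ofLp)) =
        ∑ i, (hM.eigenvalues i * x i) • hM.eigenvectorBasis i := by
      ext j
      simp only [WithLp.ofLp_sum, WithLp.ofLp_smul, mulVec_sum, mulVec_smul,
        hM.mulVec_eigenvectorBasis, smul_smul, Finset.sum_apply, Pi.smul_apply]
      simp [mul_comm]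
    have e2 := congrArg (fun u => inner ℝ u (∑ i, x i • hM.eigenvectorBasis i)) e
    simp only [hM.eigenvectorBasis.orthonormal.inner_sum] at e2
    rw [EuclideanSpace.inner_eq_star_dotProduct] at e2
    simp only [star_trivial] at e2
    rw [e2]
    simp
    exact Finset.sum_congr rfl fun i _ => by ring
  -- By rotation invariance, the coordinates in an eigenbasis of `M` are again independent standard
  -- Gaussians.
  rw [stdGaussian_eq_map_pi_orthonormalBasis hM.eigenvectorBasis, map_measureReal_apply]
  · simp only [Set.preimage_ofPred_eq, hform]
    exact sum_sq_tail hl hsum ht htd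
  · fun_prop
  · apply measurableSet_lt <;> fun_prop

lemma gaussianReal_tail {t : ℝ} (ht : 0 < t) :
    (gaussianReal 0 1).real {x | √(6 * t) < |x|} ≤ 2 * Real.exp (-3 * t) := by
  have hs : HasSubgaussianMGF (fun x : ℝ => x) 1 (gaussianReal 0 1) :=
    ⟨fun s => integrable_exp_mul_gaussianReal s, fun s => by
      rw [mgf_gaussianReal (μ := 0) (v := 1) (by simp)]; simp⟩
  have e : -√(6 * t) ^ 2 / (2 * ((1 : NNReal) : ℝ)) = -3 * t := by
    rw [Real.sq_sqrt (by positivity)]; norm_num; ring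
  have h1 := hs.measure_ge_le (Real.sqrt_nonneg (6 * t))
  have h2 := hs.neg.measure_ge_le (Real.sqrt_nonneg (6 * t))
  rw [e] at h1 h2
  calc _ ≤ (gaussianReal 0 1).real ({x | √(6 * t) ≤ x} ∪ {x | √(6 * t) ≤ (-fun x : ℝ => x) x}) := by
        apply measureReal_mono _ (measure_ne_top _ _)
        intro x hx
        have hx' : √(6 * t) < |x| := hx
        rcases lt_abs.1 hx' with h | h
        · exact Or.inl h.le
        · exact Or.inr h.le
    _ ≤ _ := (measureReal_union_le _ _).trans (by linarith)

lemma linear_form_tail (c : EuclideanSpace ℝ ι) {t : ℝ} (ht : 0 < t) :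
    (stdGaussian (EuclideanSpace ℝ ι)).real {w | √(6 * t) * ‖c‖ < |inner ℝ c w|} ≤
      2 * Real.exp (-3 * t) := by
  have hlaw : (stdGaussian (EuclideanSpace ℝ ι)).map (innerSL ℝ c) =
      (gaussianReal 0 1).map (fun x => ‖c‖ * x) := by
    rw [IsGaussian.map_eq_gaussianReal, gaussianReal_map_const_mul, variance_dual_stdGaussian,
      innerSL_apply_norm]
    congr 1
    · rw [integral_strongDual_stdGaussian]; simp
    · ext; simp
  have hset : MeasurableSet {x : ℝ | √(6 * t) * ‖c‖ < |x|} := by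
    apply measurableSet_lt <;> fun_prop
  have h1 : (stdGaussian (EuclideanSpace ℝ ι)).real {w | √(6 * t) * ‖c‖ < |inner ℝ c w|} =
      ((stdGaussian (EuclideanSpace ℝ ι)).map (innerSL ℝ c)).real
        {x : ℝ | √(6 * t) * ‖c‖ < |x|} := by
    rw [map_measureReal_apply (by fun_prop) hset]; rfl
  rw [h1, hlaw, map_measureReal_apply (by fun_prop) hset]
  refine (measureReal_mono ?_ (measure_ne_top _ _)).trans (gaussianReal_tail ht)
  intro x hx
  simp only [Set.preimage_ofPred_eq, Set.mem_ofPred_eq, abs_mul, abs_norm] at hx ⊢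
  rw [mul_comm] at hx
  exact lt_of_mul_lt_mul_left hx (norm_nonneg c)

variable {p m N : ℕ}

/-! ### The within-class projection -/

/-- The matrix of the orthogonal projection `w ↦ w - (class averages of w)`. -/
noncomputable def withinProj (y : Fin N → Fin (m + 1)) : Matrix (Fin N) (Fin N) ℝ :=
  Matrix.of fun i i' =>
    (if i = i' then 1 else 0) - if y i' = y i then (classCount y (y i) : ℝ)⁻¹ else 0

/-- The average of `w` over the class `k`. -/
noncomputable def classAvg (y : Fin N → Fin (m + 1)) (w : Fin N → ℝ) (k : Fin (m + 1)) : ℝ :=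
  (classCount y k : ℝ)⁻¹ * ∑ i with y i = k, w i

lemma classCount_pos (y : Fin N → Fin (m + 1)) (i : Fin N) : 0 < classCount y (y i) :=
  Finset.card_pos.2 ⟨i, by simp⟩

lemma withinProj_mulVec (y : Fin N → Fin (m + 1)) (w : Fin N → ℝ) (i : Fin N) :
    (withinProj y *ᵥ w) i = w i - classAvg y w (y i) := by
  simp [withinProj, mulVec, dotProduct, sub_mul, Finset.sum_sub_distrib, classAvg, Finset.sum_filter,
    Finset.mul_sum]

lemma withinProj_isHermitian (y : Fin N → Fin (m + 1)) : (withinProj y).IsHermitian := by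
  ext i i'
  simp only [withinProj, conjTranspose_apply, of_apply, star_trivial]
  congr 1
  · simp [eq_comm]
  · by_cases h : y i = y i'
    · simp [h]
    · simp [h, Ne.symm h]

lemma classAvg_const (y : Fin N → Fin (m + 1)) (f : Fin (m + 1) → ℝ) {k : Fin (m + 1)}
    (hk : 0 < classCount y k) : classAvg y (fun i => f (y i)) k = f k := by
  have : ∑ i with y i = k, f (y i) = classCount y k * f k := by
    rw [Finset.sum_congr rfl (g := fun _ => f k) (by simp +contextual)]
    simp [classCount]
  rw [classAvg, this, inv_mul_cancel_left₀ (by positivity)]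

lemma classAvg_sub (y : Fin N → Fin (m + 1)) (v w : Fin N → ℝ) (k : Fin (m + 1)) :
    classAvg y (fun i => v i - w i) k = classAvg y v k - classAvg y w k := by
  simp [classAvg, Finset.sum_sub_distrib, mul_sub]

lemma withinProj_mul_self (y : Fin N → Fin (m + 1)) : withinProj y * withinProj y = withinProj y := by
  apply mulVec_injective
  funext w i
  rw [← mulVec_mulVec, withinProj_mulVec, sub_eq_self]
  rw [show withinProj y *ᵥ w = fun i => w i - classAvg y w (y i) from
    funext (withinProj_mulVec y w), classAvg_sub, classAvg_const y _ (classCount_pos y i), sub_self]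

/-- Each nonempty class contributes `n_k · n_k⁻¹ = 1` to the trace of the averaging operator; all
classes must be observed for the total to be `K`. -/
lemma withinProj_trace {y : Fin N → Fin (m + 1)} (hy : ∀ k, 0 < classCount y k) :
    (withinProj y).trace = (N : ℝ) - (m + 1 : ℕ) := by
  have h : ∑ i, (classCount y (y i) : ℝ)⁻¹ = (m + 1 : ℕ) := by
    rw [← Finset.sum_fiberwise (s := Finset.univ) (g := y)]
    rw [Finset.sum_congr rfl (g := fun _ => (1 : ℝ))]
    · simp
    · intro k _
      rw [Finset.sum_congr rfl (g := fun _ => (classCount y k : ℝ)⁻¹) (by simp +contextual)]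
      have : (classCount y k : ℝ) ≠ 0 := by exact_mod_cast (hy k).ne'
      simp only [Finset.sum_const, nsmul_eq_mul]
      exact mul_inv_cancel₀ this
  simp [withinProj, trace, Finset.sum_sub_distrib, h]

/-- The left side is `⟨Πu, Πw⟩` for the within-class projection `Π`, which is symmetric and
idempotent. -/
lemma sum_within_mul (y : Fin N → Fin (m + 1)) (u w : Fin N → ℝ) :
    ∑ k, ∑ i with y i = k, (u i - classAvg y u k) * (w i - classAvg y w k) =
      u ⬝ᵥ withinProj y *ᵥ w := by
  have e : ∑ k, ∑ i with y i = k, (u i - classAvg y u k) * (w i - classAvg y w k) =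
      (withinProj y *ᵥ u) ⬝ᵥ (withinProj y *ᵥ w) := by
    rw [dotProduct, ← Finset.sum_fiberwise (s := Finset.univ) (g := y)]
    refine Finset.sum_congr rfl fun k _ => Finset.sum_congr rfl fun i hi => ?_
    rw [withinProj_mulVec, withinProj_mulVec, (Finset.mem_filter.1 hi).2]
  rw [e, dotProduct_comm, dotProduct_mulVec, vecMul_mulVec, ← mulVec_transpose,
    transpose_mul, transpose_transpose, show (withinProj y)ᵀ = withinProj y from
      (conjTranspose_eq_transpose_of_trivial _).symm.trans (withinProj_isHermitian y).eq, withinProj_mul_self, dotProduct_comm]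

/-! ### Scores of the centred observations -/

/-- The linear scores `⟨v, x_i - μ_{y_i}⟩`. -/
noncomputable def score (mu : Fin (m + 1) → EuclideanSpace ℝ (Fin p)) (y : Fin N → Fin (m + 1))
    (v : Fin p → ℝ) (x : Fin N → EuclideanSpace ℝ (Fin p)) : EuclideanSpace ℝ (Fin N) :=
  WithLp.toLp 2 fun i => v ⬝ᵥ (x i - mu (y i)).ofLp

lemma score_add (mu : Fin (m + 1) → EuclideanSpace ℝ (Fin p)) (y : Fin N → Fin (m + 1))
    (u v : Fin p → ℝ) (x : Fin N → EuclideanSpace ℝ (Fin p)) :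
    score mu y (u + v) x = score mu y u x + score mu y v x := by
  ext i; simp [score, add_dotProduct]; ring

lemma score_smul (mu : Fin (m + 1) → EuclideanSpace ℝ (Fin p)) (y : Fin N → Fin (m + 1))
    (c : ℝ) (v : Fin p → ℝ) (x : Fin N → EuclideanSpace ℝ (Fin p)) :
    score mu y (c • v) x = c • score mu y v x := by
  ext i; simp [score]; ring

lemma score_single (mu : Fin (m + 1) → EuclideanSpace ℝ (Fin p)) (y : Fin N → Fin (m + 1))
    (j : Fin p) (x : Fin N → EuclideanSpace ℝ (Fin p)) (i : Fin N) :
    score mu y (Pi.single j 1) x i = x i j - mu (y i) j := by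
  simp [score]

/-- Within-class centring is insensitive to class-constant shifts, so the data may be centred at the
true means. This turns `e_j' S b` into a bilinear form in centred Gaussian scores. -/
lemma pooledCov_mulVec {y : Fin N → Fin (m + 1)} (hy : ∀ k, 0 < classCount y k)
    (mu : Fin (m + 1) → EuclideanSpace ℝ (Fin p)) (x : Fin N → EuclideanSpace ℝ (Fin p))
    (b : Fin p → ℝ) (j : Fin p) :
    (pooledCov x y *ᵥ b) j = ((N : ℝ) - (m + 1 : ℕ))⁻¹ *
      ((score mu y (Pi.single j 1) x).ofLp ⬝ᵥ withinProj y *ᵥ (score mu y b x).ofLp) := by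
  have hc : ∀ a k, classAvg y (fun i => x i a - mu (y i) a) k = classMean x y k a - mu k a := by
    intro a k
    rw [classAvg_sub, classAvg_const y (fun k => mu k a) (hy k)]; rfl
  have hs : ∀ k, classAvg y (score mu y b x).ofLp k = ∑ a, b a * (classMean x y k a - mu k a) := by
    intro k
    simp_rw [← hc, classAvg, score, dotProduct, Finset.mul_sum]
    rw [Finset.sum_comm]
    exact Finset.sum_congr rfl fun a _ => Finset.sum_congr rfl fun i _ => by simp; ring
  have h1 : classAvg y (score mu y (Pi.single j 1) x).ofLp =
      fun k => classMean x y k j - mu k j := by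
    funext k
    rw [← hc]; congr 1; funext i; exact score_single mu y j x i
  rw [← sum_within_mul, h1]
  simp_rw [hs]
  simp only [mulVec, dotProduct, pooledCov, of_apply]
  simp_rw [mul_assoc, ← Finset.mul_sum]
  congr 1
  simp_rw [Finset.sum_mul]
  rw [Finset.sum_comm]
  refine Finset.sum_congr rfl fun k _ => ?_
  rw [Finset.sum_comm]
  refine Finset.sum_congr rfl fun i hi => ?_
  obtain rfl := (Finset.mem_filter.1 hi).2
  rw [score_single, sub_sub_sub_cancel_right]
  simp only [score, dotProduct, ← Finset.sum_sub_distrib, Finset.mul_sum]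
  exact Finset.sum_congr rfl fun a _ => by simp; ring

/-- The contrast `1_{y = 0} / n_0 - 1_{y = k + 1} / n_{k + 1}`. -/
noncomputable def contrast (y : Fin N → Fin (m + 1)) (k : Fin m) : EuclideanSpace ℝ (Fin N) :=
  WithLp.toLp 2 fun i => (if y i = 0 then (classCount y 0 : ℝ)⁻¹ else 0) -
    if y i = k.succ then (classCount y k.succ : ℝ)⁻¹ else 0

lemma norm_contrast {y : Fin N → Fin (m + 1)} (hy : ∀ k, 0 < classCount y k) (k : Fin m) :
    ‖contrast y k‖ = √((classCount y 0 : ℝ)⁻¹ + (classCount y k.succ : ℝ)⁻¹) := by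
  rw [EuclideanSpace.norm_eq]
  congr 1
  -- The two indicators have disjoint supports, so there is no cross term.
  have h : ∀ i, ‖contrast y k i‖ ^ 2 = (if y i = 0 then ((classCount y 0 : ℝ)⁻¹) ^ 2 else 0) +
      if y i = k.succ then ((classCount y k.succ : ℝ)⁻¹) ^ 2 else 0 := by
    intro i
    simp only [contrast, Real.norm_eq_abs, sq_abs]
    by_cases h0 : y i = 0
    · simp [h0, (Fin.succ_ne_zero k).symm]
    · by_cases h1 : y i = k.succ <;> simp [h0, h1]
  have hs : ∀ l, ∑ i, (if y i = l then ((classCount y l : ℝ)⁻¹) ^ 2 else 0) =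
      (classCount y l : ℝ)⁻¹ := by
    intro l
    have : (classCount y l : ℝ) ≠ 0 := by exact_mod_cast (hy l).ne'
    rw [← Finset.sum_filter, Finset.sum_const, nsmul_eq_mul,
      show ((Finset.univ.filter fun i => y i = l).card : ℝ) = classCount y l from rfl]
    field_simp
  simp_rw [h, Finset.sum_add_distrib, hs]

lemma meanDiffHat_sub {y : Fin N → Fin (m + 1)} (hy : ∀ k, 0 < classCount y k)
    (mu : Fin (m + 1) → EuclideanSpace ℝ (Fin p)) (x : Fin N → EuclideanSpace ℝ (Fin p))
    (k : Fin m) (j : Fin p) :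
    meanDiffHat x y k j - meanDiff mu k j =
      inner ℝ (contrast y k) (score mu y (Pi.single j 1) x) := by
  have hc : ∀ k, classMean x y k j - mu k j = classAvg y (fun i => x i j - mu (y i) j) k := by
    intro k
    rw [classAvg_sub, classAvg_const y (fun k => mu k j) (hy k)]; rfl
  calc _ = (classMean x y 0 j - mu 0 j) - (classMean x y k.succ j - mu k.succ j) := by
        simp only [meanDiffHat, meanDiff]; ring
    _ = _ := by
        rw [hc, hc, PiLp.inner_apply]
        simp_rw [score_single]
        simp only [contrast, classAvg, Finset.sum_filter, Finset.mul_sum, ← Finset.sum_sub_distrib]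
        refine Finset.sum_congr rfl fun i _ => ?_
        simp only [RCLike.inner_apply, conj_trivial, mul_sub, mul_ite, mul_zero]
        congr 1 <;> split_ifs <;> ring

/-! ### Tail bounds for a fixed design -/

section FixedDesign

variable {mu : Fin (m + 1) → EuclideanSpace ℝ (Fin p)} {Sig : Matrix (Fin p) (Fin p) ℝ}

/-- The law of the observations given that the labels are `y`. -/
noncomputable abbrev designLaw (mu : Fin (m + 1) → EuclideanSpace ℝ (Fin p))
    (Sig : Matrix (Fin p) (Fin p) ℝ) (y : Fin N → Fin (m + 1)) :
    Measure (Fin N → EuclideanSpace ℝ (Fin p)) :=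
  Measure.pi fun i => multivariateGaussian (mu (y i)) Sig

lemma measurable_score (mu : Fin (m + 1) → EuclideanSpace ℝ (Fin p)) (y : Fin N → Fin (m + 1))
    (v : Fin p → ℝ) : Measurable (score mu y v) := by
  unfold score dotProduct
  fun_prop

lemma map_multivariateGaussian_dotProduct (hS : Sig.PosSemidef) (μ : EuclideanSpace ℝ (Fin p))
    (v : Fin p → ℝ) :
    (multivariateGaussian μ Sig).map (fun x => v ⬝ᵥ (x - μ).ofLp) =
      (gaussianReal 0 1).map (fun x => √(v ⬝ᵥ Sig *ᵥ v) * x) := by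
  have hv : 0 ≤ v ⬝ᵥ Sig *ᵥ v := by simpa using hS.dotProduct_mulVec_nonneg v
  have e : (fun x : EuclideanSpace ℝ (Fin p) => v ⬝ᵥ (x - μ).ofLp) =
      (fun r => r - v ⬝ᵥ μ.ofLp) ∘ (innerSL ℝ (WithLp.toLp 2 v)) := by
    funext x
    simp [PiLp.inner_apply, dotProduct, mul_sub, Finset.sum_sub_distrib, mul_comm]
  rw [e, ← Measure.map_map (by fun_prop) (by fun_prop), IsGaussian.map_eq_gaussianReal,
    gaussianReal_map_sub_const, gaussianReal_map_const_mul]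
  congr 1
  · rw [ContinuousLinearMap.integral_comp_id_comm IsGaussian.integrable_id,
      integral_id_multivariateGaussian]
    simp [PiLp.inner_apply, dotProduct, mul_comm]
  · have : Var[innerSL ℝ (WithLp.toLp 2 v); multivariateGaussian μ Sig] = v ⬝ᵥ Sig *ᵥ v := by
      have h := covarianceBilin_multivariateGaussian (μ := μ) hS (WithLp.toLp 2 v) (WithLp.toLp 2 v)
      rw [covarianceBilin_self IsGaussian.memLp_two_id] at h
      exact h
    rw [this]
    ext
    simp [Real.sq_sqrt hv, hv]

/-- The scores of different observations are independent `𝒩(0, v'Σv)`, so the dimension `p`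
disappears from the tail bounds. -/
lemma map_score (hS : Sig.PosSemidef) (y : Fin N → Fin (m + 1)) (v : Fin p → ℝ) :
    (designLaw mu Sig y).map (score mu y v) =
      (stdGaussian (EuclideanSpace ℝ (Fin N))).map (fun w => √(v ⬝ᵥ Sig *ᵥ v) • w) := by
  set s := √(v ⬝ᵥ Sig *ᵥ v)
  have e1 : score mu y v = WithLp.toLp 2 ∘
      (fun x : Fin N → EuclideanSpace ℝ (Fin p) => fun i => v ⬝ᵥ (x i - mu (y i)).ofLp) := rfl
  have hm : ∀ i, Measurable fun x : EuclideanSpace ℝ (Fin p) => v ⬝ᵥ (x - mu (y i)).ofLp := by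
    intro i; unfold dotProduct; fun_prop
  have e2 := Measure.pi_map_pi (μ := fun i : Fin N => multivariateGaussian (mu (y i)) Sig)
    (f := fun i x => v ⬝ᵥ (x - mu (y i)).ofLp) (fun i => (hm i).aemeasurable)
  have e3 := Measure.pi_map_pi (μ := fun _ : Fin N => gaussianReal 0 1)
    (f := fun _ x => s * x) (fun i => by fun_prop)
  rw [e1, ← Measure.map_map (by fun_prop) (by fun_prop), e2]
  simp_rw [map_multivariateGaussian_dotProduct hS]
  rw [← e3, ← map_pi_eq_stdGaussian, Measure.map_map (by fun_prop) (by fun_prop),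
    Measure.map_map (by fun_prop) (by fun_prop)]
  rfl

lemma mean_noise_tail (hS : Sig.PosSemidef) {y : Fin N → Fin (m + 1)}
    (hy : ∀ k, 0 < classCount y k) (j : Fin p) (k : Fin m) {t : ℝ} (ht : 0 < t) :
    (designLaw mu Sig y).real {x | √(6 * t) *
        √(Sig j j * ((classCount y 0 : ℝ)⁻¹ + (classCount y k.succ : ℝ)⁻¹)) <
          |meanDiffHat x y k j - meanDiff mu k j|} ≤ 2 * Real.exp (-3 * t) := by
  have hjj : Pi.single j 1 ⬝ᵥ Sig *ᵥ Pi.single j 1 = Sig j j := by simp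
  have hset : MeasurableSet {w : EuclideanSpace ℝ (Fin N) |
      √(6 * t) * (√(Sig j j) * ‖contrast y k‖) < |inner ℝ (contrast y k) w|} := by
    apply measurableSet_lt <;> fun_prop
  simp_rw [meanDiffHat_sub hy mu, Real.sqrt_mul (hS.diag_nonneg (i := j)), ← norm_contrast hy]
  have h := map_measureReal_apply (μ := designLaw mu Sig y)
    (measurable_score mu y (Pi.single j 1)) hset
  rw [map_score hS, hjj, map_measureReal_apply (by fun_prop) hset] at h
  refine h.ge.trans ((measureReal_mono ?_ (measure_ne_top _ _)).trans
    (linear_form_tail (contrast y k) ht))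
  intro w hw
  have hw' : √(6 * t) * (√(Sig j j) * ‖contrast y k‖) < |inner ℝ (contrast y k) (√(Sig j j) • w)| :=
    hw
  rw [inner_smul_right, abs_mul, abs_of_nonneg (Real.sqrt_nonneg _), mul_left_comm] at hw'
  exact lt_of_mul_lt_mul_left hw' (Real.sqrt_nonneg _)

lemma quadratic_score_tail (hS : Sig.PosSemidef) {y : Fin N → Fin (m + 1)}
    (hy : ∀ k, 0 < classCount y k) (v : Fin p → ℝ) {t : ℝ} (ht : 0 < t)
    (htd : t ≤ (N : ℝ) - (m + 1 : ℕ)) :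
    (designLaw mu Sig y).real {x | 25 / 2 * √(((N : ℝ) - (m + 1 : ℕ)) * t) * (v ⬝ᵥ Sig *ᵥ v) <
      |(score mu y v x).ofLp ⬝ᵥ withinProj y *ᵥ (score mu y v x).ofLp -
        ((N : ℝ) - (m + 1 : ℕ)) * (v ⬝ᵥ Sig *ᵥ v)|} ≤ 2 * Real.exp (-3 * t) := by
  set d : ℝ := (N : ℝ) - (m + 1 : ℕ)
  have hv : 0 ≤ v ⬝ᵥ Sig *ᵥ v := by simpa using hS.dotProduct_mulVec_nonneg v
  have hset : MeasurableSet {w : EuclideanSpace ℝ (Fin N) |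
      25 / 2 * √(d * t) * (v ⬝ᵥ Sig *ᵥ v) <
        |w.ofLp ⬝ᵥ withinProj y *ᵥ w.ofLp - d * (v ⬝ᵥ Sig *ᵥ v)|} := by
    apply measurableSet_lt <;> unfold dotProduct mulVec <;> fun_prop
  have h := map_measureReal_apply (μ := designLaw mu Sig y) (measurable_score mu y v) hset
  rw [map_score hS, map_measureReal_apply (by fun_prop) hset] at h
  refine h.ge.trans ((measureReal_mono ?_ (measure_ne_top _ _)).trans
    (projection_form_tail (withinProj_isHermitian y) (withinProj_mul_self y)
      (withinProj_trace hy) ht htd))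
  intro w hw
  set s := √(v ⬝ᵥ Sig *ᵥ v) with hs
  have hw' : 25 / 2 * √(d * t) * (v ⬝ᵥ Sig *ᵥ v) <
      |(s • w).ofLp ⬝ᵥ withinProj y *ᵥ (s • w).ofLp - d * (v ⬝ᵥ Sig *ᵥ v)| := hw
  rw [WithLp.ofLp_smul, mulVec_smul, dotProduct_smul, smul_dotProduct, smul_smul, hs,
    Real.mul_self_sqrt hv, smul_eq_mul, mul_comm (_ * √_), mul_comm d (v ⬝ᵥ Sig *ᵥ v), ← mul_sub, abs_mul, abs_of_nonneg hv] at hw'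
  exact lt_of_mul_lt_mul_left hw' hv

/-- Polarization after normalizing `u` and `v` in the `Σ`-norm. Two quadratic tail events are used,
hence the factor `4`. -/
lemma cross_score_tail (hS : Sig.PosDef) {y : Fin N → Fin (m + 1)}
    (hy : ∀ k, 0 < classCount y k) (u v : Fin p → ℝ) {t : ℝ} (ht : 0 < t)
    (htd : t ≤ (N : ℝ) - (m + 1 : ℕ)) :
    (designLaw mu Sig y).real {x | 25 / 2 * √(((N : ℝ) - (m + 1 : ℕ)) * t) *
        (√(u ⬝ᵥ Sig *ᵥ u) * √(v ⬝ᵥ Sig *ᵥ v)) <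
      |(score mu y u x).ofLp ⬝ᵥ withinProj y *ᵥ (score mu y v x).ofLp -
        ((N : ℝ) - (m + 1 : ℕ)) * (u ⬝ᵥ Sig *ᵥ v)|} ≤ 4 * Real.exp (-3 * t) := by
  -- Normalization requires nonzero vectors; if one vanishes, both sides of the strict inequality
  -- are zero and the event is empty.
  rcases eq_or_ne u 0 with rfl | hu
  · simp [score, ← Pi.zero_def, Real.exp_nonneg]
  rcases eq_or_ne v 0 with rfl | hv
  · simp [score, ← Pi.zero_def, Real.exp_nonneg]
  set d : ℝ := (N : ℝ) - (m + 1 : ℕ)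
  have hsym : ∀ (n : ℕ) (A : Matrix (Fin n) (Fin n) ℝ), A.IsHermitian → ∀ a b : Fin n → ℝ,
      a ⬝ᵥ A *ᵥ b = b ⬝ᵥ A *ᵥ a := by
    intro n A hA a b
    have hA' : Aᵀ = A := (conjTranspose_eq_transpose_of_trivial A).symm.trans hA.eq
    rw [dotProduct_mulVec, ← mulVec_transpose, hA', dotProduct_comm]
  have hup : 0 < u ⬝ᵥ Sig *ᵥ u := by simpa using hS.dotProduct_mulVec_pos hu
  have hvp : 0 < v ⬝ᵥ Sig *ᵥ v := by simpa using hS.dotProduct_mulVec_pos hv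
  set σ := √(u ⬝ᵥ Sig *ᵥ u) with hσ
  set τ := √(v ⬝ᵥ Sig *ᵥ v) with hτ
  have hσ0 : 0 < σ := Real.sqrt_pos.2 hup
  have hτ0 : 0 < τ := Real.sqrt_pos.2 hvp
  have hσ2 : u ⬝ᵥ Sig *ᵥ u = σ ^ 2 := (Real.sq_sqrt hup.le).symm
  have hτ2 : v ⬝ᵥ Sig *ᵥ v = τ ^ 2 := (Real.sq_sqrt hvp.le).symm
  set q := σ⁻¹ • u + τ⁻¹ • v with hq
  set r := σ⁻¹ • u + (-τ⁻¹) • v with hr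
  have expand : ∀ (n : ℕ) (A : Matrix (Fin n) (Fin n) ℝ), A.IsHermitian → ∀ (a b : Fin n → ℝ)
      (α β : ℝ), (α • a + β • b) ⬝ᵥ A *ᵥ (α • a + β • b) =
        α ^ 2 * (a ⬝ᵥ A *ᵥ a) + 2 * α * β * (a ⬝ᵥ A *ᵥ b) + β ^ 2 * (b ⬝ᵥ A *ᵥ b) := by
    intro n A hA a b α β
    simp only [mulVec_add, mulVec_smul, dotProduct_add, add_dotProduct, smul_dotProduct,
      dotProduct_smul, smul_eq_mul, hsym n A hA b a]
    ring
  have hqS : q ⬝ᵥ Sig *ᵥ q = 2 + 2 * (u ⬝ᵥ Sig *ᵥ v) / (σ * τ) := by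
    rw [hq, expand _ _ hS.isHermitian, hσ2, hτ2]; field_simp; ring
  have hrS : r ⬝ᵥ Sig *ᵥ r = 2 - 2 * (u ⬝ᵥ Sig *ᵥ v) / (σ * τ) := by
    rw [hr, expand _ _ hS.isHermitian, hσ2, hτ2]; field_simp; ring
  have h1 := quadratic_score_tail (mu := mu) hS.posSemidef hy q ht htd
  have h2 := quadratic_score_tail (mu := mu) hS.posSemidef hy r ht htd
  refine (measureReal_mono ?_ (measure_ne_top _ _)).trans
    ((measureReal_union_le _ _).trans ((add_le_add h1 h2).trans (by linarith)))
  intro x hx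
  by_contra hcon
  have hx' : 25 / 2 * √(d * t) * (σ * τ) < |(score mu y u x).ofLp ⬝ᵥ withinProj y *ᵥ
      (score mu y v x).ofLp - d * (u ⬝ᵥ Sig *ᵥ v)| := hx
  rw [Set.mem_union, not_or] at hcon
  have g1 : |(score mu y q x).ofLp ⬝ᵥ withinProj y *ᵥ (score mu y q x).ofLp -
      d * (q ⬝ᵥ Sig *ᵥ q)| ≤ 25 / 2 * √(d * t) * (q ⬝ᵥ Sig *ᵥ q) := not_lt.1 hcon.1
  have g2 : |(score mu y r x).ofLp ⬝ᵥ withinProj y *ᵥ (score mu y r x).ofLp -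
      d * (r ⬝ᵥ Sig *ᵥ r)| ≤ 25 / 2 * √(d * t) * (r ⬝ᵥ Sig *ᵥ r) := not_lt.1 hcon.2
  rw [hqS] at g1
  rw [hrS] at g2
  simp only [hq, hr, score_add, score_smul, WithLp.ofLp_add, WithLp.ofLp_smul,
    expand _ _ (withinProj_isHermitian y)] at g1 g2
  set A := (score mu y u x).ofLp ⬝ᵥ withinProj y *ᵥ (score mu y u x).ofLp
  set B := (score mu y v x).ofLp ⬝ᵥ withinProj y *ᵥ (score mu y v x).ofLp
  set C := (score mu y u x).ofLp ⬝ᵥ withinProj y *ᵥ (score mu y v x).ofLp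
  set ρ := u ⬝ᵥ Sig *ᵥ v
  have key : 4 * ((C - d * ρ) / (σ * τ)) =
      (σ⁻¹ ^ 2 * A + 2 * σ⁻¹ * τ⁻¹ * C + τ⁻¹ ^ 2 * B - d * (2 + 2 * ρ / (σ * τ))) -
      (σ⁻¹ ^ 2 * A + 2 * σ⁻¹ * -τ⁻¹ * C + (-τ⁻¹) ^ 2 * B - d * (2 - 2 * ρ / (σ * τ))) := by
    field_simp; ring
  -- The variances `2 ± 2ρ/(στ)` of the sum and difference add up to `4`, so polarization does not
  -- worsen the constant `25/2`.
  have h4 : |4 * ((C - d * ρ) / (σ * τ))| ≤ 4 * (25 / 2 * √(d * t)) := by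
    rw [key]
    exact (abs_sub _ _).trans ((add_le_add g1 g2).trans (by ring_nf; rfl))
  rw [abs_mul, abs_div, abs_of_pos (mul_pos hσ0 hτ0), abs_of_pos (by norm_num : (0 : ℝ) < 4)] at h4
  have h5 : |C - d * ρ| / (σ * τ) ≤ 25 / 2 * √(d * t) := by linarith
  rw [div_le_iff₀ (mul_pos hσ0 hτ0)] at h5
  exact absurd hx' (not_lt.2 h5)

end FixedDesign

/-! ### Conditioning on the labels -/

section Sampling

variable {Ω : Type*} [MeasurableSpace Ω] {P : Measure Ω}
  {X : Fin N → Ω → EuclideanSpace ℝ (Fin p)} {Y : Fin N → Ω → Fin (m + 1)}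
  {prior : Fin (m + 1) → ℝ} {mu : Fin (m + 1) → EuclideanSpace ℝ (Fin p)}
  {Sig : Matrix (Fin p) (Fin p) ℝ}

lemma measurable_labels (h : IsLDASample P X Y prior mu Sig) :
    Measurable fun ω i => Y i ω :=
  measurable_pi_iff.2 h.measurable_Y

lemma measurable_observations (h : IsLDASample P X Y prior mu Sig) :
    Measurable fun ω i => X i ω :=
  measurable_pi_iff.2 h.measurable_X

/-- There are only finitely many label vectors, so the event is a countable union of measurable
pieces even though `D` varies with `y`. -/
lemma measurableSet_labels_observations (h : IsLDASample P X Y prior mu Sig)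
    (A : Set (Fin N → Fin (m + 1)))
    {D : (Fin N → Fin (m + 1)) → Set (Fin N → EuclideanSpace ℝ (Fin p))}
    (hD : ∀ y, MeasurableSet (D y)) :
    MeasurableSet {ω | (fun i => Y i ω) ∈ A ∧ (fun i => X i ω) ∈ D (fun i => Y i ω)} := by
  have e : {ω | (fun i => Y i ω) ∈ A ∧ (fun i => X i ω) ∈ D (fun i => Y i ω)} =
      ⋃ y ∈ A, (fun ω i => Y i ω) ⁻¹' {y} ∩ (fun ω i => X i ω) ⁻¹' D y := by
    ext ω
    simp only [Set.mem_ofPred_eq, Set.mem_iUnion]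
    constructor
    · rintro ⟨h1, h2⟩
      exact ⟨_, h1, rfl, h2⟩
    · rintro ⟨y, h1, h2, h3⟩
      have h2' : (fun i => Y i ω) = y := h2
      subst h2'
      exact ⟨h1, h3⟩
  rw [e]
  exact MeasurableSet.biUnion A.to_countable fun y _ =>
    (measurable_labels h (measurableSet_singleton y)).inter (measurable_observations h (hD y))

variable [IsProbabilityMeasure P]

lemma measure_label_inter (h : IsLDASample P X Y prior mu Sig) (i : Fin N) (k : Fin (m + 1))
    {S : Set (EuclideanSpace ℝ (Fin p))} (hS : MeasurableSet S) :
    P (Y i ⁻¹' {k} ∩ X i ⁻¹' S) =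
      P (Y i ⁻¹' {k}) * multivariateGaussian (mu k) Sig S := by
  rw [← h.cond_law i k, Measure.map_apply (h.measurable_X i) hS,
    ← cond_mul_eq_inter (h.measurable_Y i (measurableSet_singleton k)), mul_comm]

/-- Given the labels `y`, the observations are independent with laws `𝒩(μ_{y_i}, Σ)`. -/
lemma measure_labels_inter (h : IsLDASample P X Y prior mu Sig) (y : Fin N → Fin (m + 1))
    {S : Set (Fin N → EuclideanSpace ℝ (Fin p))} (hS : MeasurableSet S) :
    P ((fun ω i => Y i ω) ⁻¹' {y} ∩ (fun ω i => X i ω) ⁻¹' S) =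
      P ((fun ω i => Y i ω) ⁻¹' {y}) * designLaw mu Sig y S := by
  have hX := measurable_observations h
  have hY : MeasurableSet ((fun ω i => Y i ω) ⁻¹' {y}) :=
    measurable_labels h (measurableSet_singleton y)
  have hbox : ∀ s : Fin N → Set (EuclideanSpace ℝ (Fin p)), (∀ i, MeasurableSet (s i)) →
      P ((fun ω i => Y i ω) ⁻¹' {y} ∩ (fun ω i => X i ω) ⁻¹' (Set.univ.pi s)) =
        ∏ i, P (Y i ⁻¹' {y i}) * multivariateGaussian (mu (y i)) Sig (s i) := by
    intro s hs
    have e : (fun ω i => Y i ω) ⁻¹' {y} ∩ (fun ω i => X i ω) ⁻¹' (Set.univ.pi s) =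
        ⋂ i ∈ (Finset.univ : Finset (Fin N)),
          (fun ω => (X i ω, Y i ω)) ⁻¹' (s i ×ˢ {y i}) := by
      ext ω
      simp [funext_iff, forall_and, and_comm]
    rw [e, h.indep.measure_inter_preimage_eq_mul _ (fun i _ =>
      (hs i).prod (measurableSet_singleton _))]
    refine Finset.prod_congr rfl fun i _ => ?_
    rw [← measure_label_inter h i (y i) (hs i)]
    congr 1
    ext ω
    simp [and_comm]
  have hprod : P ((fun ω i => Y i ω) ⁻¹' {y}) = ∏ i, P (Y i ⁻¹' {y i}) := by
    have := hbox (fun _ => Set.univ) fun _ => MeasurableSet.univ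
    simpa using this
  -- Both measures agree on boxes. Distributing the label probabilities over the factors presents
  -- each as the same product of finite measures, so `Measure.pi_eq` identifies them.
  have hmeas : (P.restrict ((fun ω i => Y i ω) ⁻¹' {y})).map (fun ω i => X i ω) =
      P ((fun ω i => Y i ω) ⁻¹' {y}) • designLaw mu Sig y := by
    have hc : ∀ i, ((P (Y i ⁻¹' {y i})).toNNReal : ENNReal) = P (Y i ⁻¹' {y i}) := fun i =>
      ENNReal.coe_toNNReal (measure_ne_top _ _)
    have h1 := Measure.pi_eq
      (μ := fun i => (P (Y i ⁻¹' {y i})).toNNReal • multivariateGaussian (mu (y i)) Sig)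
      (μ' := (P.restrict ((fun ω i => Y i ω) ⁻¹' {y})).map (fun ω i => X i ω)) fun s hs => by
        rw [Measure.map_apply hX (MeasurableSet.univ_pi hs),
          Measure.restrict_apply (hX (MeasurableSet.univ_pi hs)), Set.inter_comm, hbox s hs]
        simp [Measure.smul_apply, ENNReal.smul_def, hc]
    have h2 := Measure.pi_eq
      (μ := fun i => (P (Y i ⁻¹' {y i})).toNNReal • multivariateGaussian (mu (y i)) Sig)
      (μ' := P ((fun ω i => Y i ω) ⁻¹' {y}) • designLaw mu Sig y) fun s hs => by
        rw [Measure.smul_apply, Measure.pi_pi, hprod, smul_eq_mul, ← Finset.prod_mul_distrib]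
        simp [Measure.smul_apply, ENNReal.smul_def, hc]
    exact h1.symm.trans h2
  have := congrArg (fun ν => ν S) hmeas
  simp only [Measure.map_apply hX hS, Measure.restrict_apply (hX hS), Measure.smul_apply,
    smul_eq_mul] at this
  rw [← this, Set.inter_comm]

/-- The law of total probability over the label vectors in `A`, whose probabilities sum to at most
one. -/
lemma prob_of_designLaw_le (h : IsLDASample P X Y prior mu Sig) (A : Set (Fin N → Fin (m + 1)))
    {D : (Fin N → Fin (m + 1)) → Set (Fin N → EuclideanSpace ℝ (Fin p))}
    (hD : ∀ y, MeasurableSet (D y)) {ε : ℝ} (hε : 0 ≤ ε)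
    (hle : ∀ y ∈ A, (designLaw mu Sig y).real (D y) ≤ ε) :
    P.real {ω | (fun i => Y i ω) ∈ A ∧ (fun i => X i ω) ∈ D (fun i => Y i ω)} ≤ ε := by
  classical
  have hsub : {ω | (fun i => Y i ω) ∈ A ∧ (fun i => X i ω) ∈ D (fun i => Y i ω)} ⊆
      ⋃ y ∈ Finset.univ.filter (· ∈ A),
        (fun ω i => Y i ω) ⁻¹' {y} ∩ (fun ω i => X i ω) ⁻¹' D y := by
    intro ω hω
    obtain ⟨h1, h2⟩ := hω
    simp only [Set.mem_iUnion]
    exact ⟨fun i => Y i ω, by simpa using h1, rfl, h2⟩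
  refine (measureReal_mono hsub (measure_ne_top _ _)).trans
    ((measureReal_biUnion_finset_le _ _).trans ?_)
  have hterm : ∀ y ∈ Finset.univ.filter (· ∈ A),
      P.real ((fun ω i => Y i ω) ⁻¹' {y} ∩ (fun ω i => X i ω) ⁻¹' D y) ≤
        P.real ((fun ω i => Y i ω) ⁻¹' {y}) * ε := by
    intro y hy
    rw [measureReal_def, measure_labels_inter h y (hD y), ENNReal.toReal_mul]
    exact mul_le_mul_of_nonneg_left (hle y (Finset.mem_filter.1 hy).2) ENNReal.toReal_nonneg
  refine (Finset.sum_le_sum hterm).trans ?_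
  rw [← Finset.sum_mul, sum_measureReal_preimage_singleton _ fun y _ =>
    measurable_labels h (measurableSet_singleton y)]
  exact mul_le_of_le_one_left hε measureReal_le_one

end Sampling

/-! ### Row norms -/

lemma rowNorm_nonneg (b : Matrix (Fin p) (Fin m) ℝ) (j : Fin p) : 0 ≤ rowNorm b j :=
  norm_nonneg _

lemma rowNorm_eq_sqrt (b : Matrix (Fin p) (Fin m) ℝ) (j : Fin p) :
    rowNorm b j = √(∑ k, b j k ^ 2) := by
  simp [rowNorm, EuclideanSpace.norm_eq]

lemma rowNorm_add_le (a b : Matrix (Fin p) (Fin m) ℝ) (j : Fin p) :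
    rowNorm (a + b) j ≤ rowNorm a j + rowNorm b j :=
  norm_add_le (WithLp.toLp 2 (a j) : EuclideanSpace ℝ (Fin m)) (WithLp.toLp 2 (b j))

lemma rowNorm_neg (a : Matrix (Fin p) (Fin m) ℝ) (j : Fin p) :
    rowNorm (-a) j = rowNorm a j :=
  norm_neg (WithLp.toLp 2 (a j) : EuclideanSpace ℝ (Fin m))

lemma rowNorm_zero (j : Fin p) : rowNorm (0 : Matrix (Fin p) (Fin m) ℝ) j = 0 := by
  simp [rowNorm_eq_sqrt]

lemma rowNorm_congr {a b : Matrix (Fin p) (Fin m) ℝ} {j : Fin p} (h : ∀ k, a j k = b j k) :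
    rowNorm a j = rowNorm b j := by
  simp [rowNorm_eq_sqrt, h]

lemma sum_mul_le_rowNorm_mul (a b : Matrix (Fin p) (Fin m) ℝ) (j : Fin p) :
    ∑ k, a j k * b j k ≤ rowNorm a j * rowNorm b j := by
  have := real_inner_le_norm (WithLp.toLp 2 (a j) : EuclideanSpace ℝ (Fin m)) (WithLp.toLp 2 (b j))
  simpa [rowNorm, PiLp.inner_apply, mul_comm] using this

lemma rowNorm_le_of_sum_sq_le {a : Matrix (Fin p) (Fin m) ℝ} {j : Fin p} {c : ℝ} (hc : 0 ≤ c)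
    (h : ∑ k, a j k ^ 2 ≤ c ^ 2) : rowNorm a j ≤ c := by
  rw [rowNorm_eq_sqrt]
  exact Real.sqrt_le_iff.2 ⟨hc, h⟩

/-! ### The basic inequality for penalized minimizers -/

lemma pooledCov_symm (x : Fin N → EuclideanSpace ℝ (Fin p)) (y : Fin N → Fin (m + 1))
    (u v : Fin p → ℝ) : u ⬝ᵥ pooledCov x y *ᵥ v = v ⬝ᵥ pooledCov x y *ᵥ u := by
  have hT : (pooledCov x y)ᵀ = pooledCov x y := by
    ext a b
    simp only [pooledCov, transpose_apply, of_apply]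
    simp_rw [mul_comm (x _ b - _)]
  rw [dotProduct_mulVec, ← mulVec_transpose, hT, dotProduct_comm]

lemma pooledCov_nonneg {y : Fin N → Fin (m + 1)} (hy : ∀ k, 0 < classCount y k)
    (hN : m + 1 < N) (x : Fin N → EuclideanSpace ℝ (Fin p)) (v : Fin p → ℝ) :
    0 ≤ v ⬝ᵥ pooledCov x y *ᵥ v := by
  have hd : (0 : ℝ) < (N : ℝ) - (m + 1 : ℕ) := sub_pos.2 (by exact_mod_cast hN)
  -- The representation by scores holds for any centring; zero is the simplest.
  have e : v ⬝ᵥ pooledCov x y *ᵥ v = ((N : ℝ) - (m + 1 : ℕ))⁻¹ *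
      ((score 0 y v x).ofLp ⬝ᵥ withinProj y *ᵥ (score 0 y v x).ofLp) := by
    rw [dotProduct]
    simp_rw [pooledCov_mulVec hy 0]
    have hs : (score 0 y v x).ofLp = ∑ j, v j • (score 0 y (Pi.single j 1) x).ofLp := by
      ext i
      simp [score_single]
      simp [score, dotProduct]
    conv_rhs => rw [hs]
    rw [sum_dotProduct, Finset.mul_sum, ← hs]
    exact Finset.sum_congr rfl fun j _ => by rw [smul_dotProduct, smul_eq_mul]; ring
  rw [e, ← sum_within_mul]
  refine mul_nonneg (inv_nonneg.2 hd.le) (Finset.sum_nonneg fun k _ => Finset.sum_nonneg fun i _ =>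
    mul_self_nonneg _)

/-- The gradient `S b_k - δ̂_k` of the smooth part of the objective. -/
noncomputable def gradient (x : Fin N → EuclideanSpace ℝ (Fin p)) (y : Fin N → Fin (m + 1))
    (b : Matrix (Fin p) (Fin m) ℝ) : Matrix (Fin p) (Fin m) ℝ :=
  Matrix.of fun j k => (pooledCov x y *ᵥ bᵀ k) j - meanDiffHat x y k j

/-- The quadratic part lies above its tangent at `b`, and Cauchy–Schwarz in each row bounds the
remaining linear term. -/
lemma basic_inequality {x : Fin N → EuclideanSpace ℝ (Fin p)} {y : Fin N → Fin (m + 1)}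
    (hy : ∀ k, 0 < classCount y k) (hN : m + 1 < N) {lam : Fin p → ℝ}
    {bh : Matrix (Fin p) (Fin m) ℝ} (h : IsEstimator x y lam bh) (b : Matrix (Fin p) (Fin m) ℝ) :
    ∑ j, lam j * rowNorm bh j ≤
      ∑ j, lam j * rowNorm b j + ∑ j, rowNorm (gradient x y b) j * rowNorm (bh - b) j := by
  have hf := h b
  have hconv : ∀ k, (1 / 2 : ℝ) * (bᵀ k ⬝ᵥ pooledCov x y *ᵥ bᵀ k) +
      (bh - b)ᵀ k ⬝ᵥ pooledCov x y *ᵥ bᵀ k ≤ (1 / 2 : ℝ) * (bhᵀ k ⬝ᵥ pooledCov x y *ᵥ bhᵀ k) := by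
    intro k
    have h0 := pooledCov_nonneg hy hN x ((bh - b)ᵀ k)
    have e : bhᵀ k = (bh - b)ᵀ k + bᵀ k := by ext j; simp
    rw [e]
    simp only [mulVec_add, dotProduct_add, add_dotProduct,
      pooledCov_symm x y (bᵀ k) ((bh - b)ᵀ k)]
    linarith
  have hconv' := Finset.sum_le_sum fun k (_ : k ∈ Finset.univ) => hconv k
  rw [Finset.sum_add_distrib] at hconv'
  have hlin : ∑ k, meanDiffHat x y k ⬝ᵥ bhᵀ k - ∑ k, meanDiffHat x y k ⬝ᵥ bᵀ k -
      ∑ k, (bh - b)ᵀ k ⬝ᵥ pooledCov x y *ᵥ bᵀ k =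
      ∑ j, ∑ k, (-gradient x y b) j k * (bh - b) j k := by
    rw [Finset.sum_comm, ← Finset.sum_sub_distrib, ← Finset.sum_sub_distrib]
    refine Finset.sum_congr rfl fun k _ => ?_
    simp only [dotProduct, ← Finset.sum_sub_distrib]
    refine Finset.sum_congr rfl fun j _ => ?_
    simp [gradient]
    ring
  have hcs : ∑ j, ∑ k, (-gradient x y b) j k * (bh - b) j k ≤
      ∑ j, rowNorm (gradient x y b) j * rowNorm (bh - b) j :=
    Finset.sum_le_sum fun j _ => by
      rw [← rowNorm_neg (gradient x y b)]; exact sum_mul_le_rowNorm_mul _ _ j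
  simp only [objective] at hf
  linarith

/-- In the basic inequality at `b = 0`, each row of `β̂` carries a strictly larger weight on the
left than on the right. -/
lemma rowNorm_eq_zero_of_large_penalty {x : Fin N → EuclideanSpace ℝ (Fin p)}
    {y : Fin N → Fin (m + 1)} (hy : ∀ k, 0 < classCount y k) (hN : m + 1 < N) {lam : Fin p → ℝ}
    {bh : Matrix (Fin p) (Fin m) ℝ} (h : IsEstimator x y lam bh)
    (hlam : ∀ j, rowNorm (gradient x y 0) j < lam j) (j : Fin p) : rowNorm bh j = 0 := by
  have hb := basic_inequality hy hN h 0
  simp only [rowNorm_zero, mul_zero, Finset.sum_const_zero, zero_add, sub_zero] at hb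
  have hnn : ∀ i ∈ Finset.univ, 0 ≤ (lam i - rowNorm (gradient x y 0) i) * rowNorm bh i :=
    fun i _ => mul_nonneg (sub_nonneg.2 (hlam i).le) (rowNorm_nonneg _ _)
  have hz : ∑ i, (lam i - rowNorm (gradient x y 0) i) * rowNorm bh i = 0 := by
    refine le_antisymm ?_ (Finset.sum_nonneg hnn)
    simp_rw [sub_mul, Finset.sum_sub_distrib]
    linarith
  have := (Finset.sum_eq_zero_iff_of_nonneg hnn).1 hz j (Finset.mem_univ j)
  exact (mul_eq_zero.1 this).resolve_left (sub_pos.2 (hlam j)).ne'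

/-- The cone condition: a basic inequality with a constant penalty that is at least twice the noise
level puts the error into a cone around the support of `b`. -/
lemma cone_condition {b bh : Matrix (Fin p) (Fin m) ℝ} {lam : ℝ} (hlam : 0 < lam)
    (h : ∑ j, lam * rowNorm bh j ≤ ∑ j, lam * rowNorm b j + ∑ j, rowNorm (bh - b) j * (lam / 2)) :
    ∑ j ∈ (jointSupport b)ᶜ, rowNorm bh j ≤ 3 * ∑ j ∈ jointSupport b, rowNorm (bh - b) j := by
  have hoff : ∀ j ∈ (jointSupport b)ᶜ, ∀ k, b j k = 0 := by
    intro j hj k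
    by_contra hne
    exact (Finset.mem_compl.1 hj) (by simpa [jointSupport] using ⟨k, hne⟩)
  rw [← Finset.mul_sum, ← Finset.mul_sum, ← Finset.sum_mul] at h
  have h' : ∑ j, rowNorm bh j ≤ ∑ j, rowNorm b j + (∑ j, rowNorm (bh - b) j) / 2 :=
    le_of_mul_le_mul_left (by linarith) hlam
  rw [← Finset.sum_add_sum_compl (jointSupport b) (rowNorm bh),
    ← Finset.sum_add_sum_compl (jointSupport b) (rowNorm b),
    ← Finset.sum_add_sum_compl (jointSupport b) (rowNorm (bh - b))] at h'
  have e1 : ∑ j ∈ (jointSupport b)ᶜ, rowNorm b j = 0 :=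
    Finset.sum_eq_zero fun j hj => by rw [rowNorm_eq_sqrt]; simp [hoff j hj]
  have e2 : ∑ j ∈ (jointSupport b)ᶜ, rowNorm (bh - b) j = ∑ j ∈ (jointSupport b)ᶜ, rowNorm bh j :=
    Finset.sum_congr rfl fun j hj => rowNorm_congr fun k => by simp [hoff j hj k]
  have e3 : ∑ j ∈ jointSupport b, rowNorm b j ≤
      ∑ j ∈ jointSupport b, rowNorm bh j + ∑ j ∈ jointSupport b, rowNorm (bh - b) j := by
    rw [← Finset.sum_add_distrib]
    refine Finset.sum_le_sum fun j _ => ?_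
    have := rowNorm_add_le bh (-(bh - b)) j
    rw [rowNorm_neg, show bh + -(bh - b) = b by abel] at this
    exact this
  linarith

/-! ### Population bounds -/

section Population

variable {prior : Fin (m + 1) → ℝ} {mu : Fin (m + 1) → EuclideanSpace ℝ (Fin p)}
  {Sig : Matrix (Fin p) (Fin p) ℝ}

lemma mulVec_bayesDir (hS : Sig.PosDef) (k : Fin m) :
    Sig *ᵥ (bayesDir mu Sig)ᵀ k = meanDiff mu k := by
  have : (bayesDir mu Sig)ᵀ k = Sig⁻¹ *ᵥ meanDiff mu k := by ext j; rfl
  rw [this, mulVec_mulVec, mul_nonsing_inv _ ((isUnit_iff_isUnit_det _).1 hS.isUnit), one_mulVec]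

lemma bayesDir_variance (hS : Sig.PosDef) (k : Fin m) :
    (bayesDir mu Sig)ᵀ k ⬝ᵥ Sig *ᵥ (bayesDir mu Sig)ᵀ k =
      (Sig⁻¹ *ᵥ meanDiff mu k) ⬝ᵥ meanDiff mu k := by
  rw [mulVec_bayesDir hS]; rfl

lemma bayesDir_variance_nonneg (hS : Sig.PosDef) (k : Fin m) :
    0 ≤ (bayesDir mu Sig)ᵀ k ⬝ᵥ Sig *ᵥ (bayesDir mu Sig)ᵀ k := by
  simpa using hS.posSemidef.dotProduct_mulVec_nonneg ((bayesDir mu Sig)ᵀ k)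

lemma totalDelta_eq (hS : Sig.PosDef) :
    totalDelta mu Sig = ∑ k, (bayesDir mu Sig)ᵀ k ⬝ᵥ Sig *ᵥ (bayesDir mu Sig)ᵀ k := by
  simp_rw [bayesDir_variance hS]; rfl

/-- Cauchy–Schwarz for the inner product of `Σ`, applied to `δ_k^j = e_j' Σ β_k`, through the
discriminant of the quadratic in `s`. -/
lemma meanDiff_sq_le (hS : Sig.PosDef) (k : Fin m) (j : Fin p) :
    meanDiff mu k j ^ 2 ≤
      Sig j j * ((bayesDir mu Sig)ᵀ k ⬝ᵥ Sig *ᵥ (bayesDir mu Sig)ᵀ k) := by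
  set b := (bayesDir mu Sig)ᵀ k
  set e : Fin p → ℝ := Pi.single j 1
  have he : e ⬝ᵥ Sig *ᵥ b = meanDiff mu k j := by
    rw [mulVec_bayesDir hS]; simp [e]
  have hee : e ⬝ᵥ Sig *ᵥ e = Sig j j := by simp [e]
  have hbe : b ⬝ᵥ Sig *ᵥ e = meanDiff mu k j := by
    rw [dotProduct_mulVec, ← mulVec_transpose,
      (conjTranspose_eq_transpose_of_trivial Sig).symm.trans hS.isHermitian.eq,
      dotProduct_comm, he]
  have hq : ∀ s : ℝ, 0 ≤ Sig j j * (s * s) + (2 * meanDiff mu k j) * s + b ⬝ᵥ Sig *ᵥ b := by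
    intro s
    have h0 : 0 ≤ (s • e + b) ⬝ᵥ Sig *ᵥ (s • e + b) := by
      simpa using hS.posSemidef.dotProduct_mulVec_nonneg (s • e + b)
    simp only [mulVec_add, mulVec_smul, dotProduct_add, add_dotProduct, smul_dotProduct,
      dotProduct_smul, smul_eq_mul, he, hee, hbe] at h0
    linarith
  have := discrim_le_zero hq
  rw [discrim] at this
  linarith

lemma inv_add_inv_le_piBar (hprior : ∀ k, 0 < prior k) (k : Fin m) :
    (prior 0)⁻¹ + (prior k.succ)⁻¹ ≤ piBar prior := by
  have h := le_ciSup (f := fun k : Fin m => (prior 0 + prior k.succ) / (prior 0 * prior k.succ))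
    (Set.finite_range _).bddAbove k
  refine le_trans (le_of_eq ?_) h
  have := (hprior 0).ne'
  have := (hprior k.succ).ne'
  field_simp
  ring

/-- Allows the factor `π̄` to be inserted for free where the noise does not produce it, namely for
the covariance and for `δ_k` itself. -/
lemma one_le_piBar (hm : 1 ≤ m) (hprior : ∀ k, 0 < prior k) (h1 : prior 0 ≤ 1) :
    1 ≤ piBar prior := by
  have h := inv_add_inv_le_piBar hprior (⟨0, hm⟩ : Fin m)
  have h2 := (one_le_inv₀ (hprior 0)).2 h1
  have h3 := inv_pos.2 (hprior (Fin.succ ⟨0, hm⟩))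
  linarith

lemma inv_classCount_add_le {y : Fin N → Fin (m + 1)} (hN : m + 1 < N)
    (hprior : ∀ k, 0 < prior k)
    (hy : ∀ k, (N : ℝ) * prior k / 2 ≤ classCount y k) (k : Fin m) :
    (classCount y 0 : ℝ)⁻¹ + (classCount y k.succ : ℝ)⁻¹ ≤
      2 * piBar prior / ((N : ℝ) - (m + 1 : ℕ)) := by
  have hd : (0 : ℝ) < (N : ℝ) - (m + 1 : ℕ) := sub_pos.2 (by exact_mod_cast hN)
  have hN0 : (0 : ℝ) < N := by
    have : (0 : ℝ) ≤ ((m + 1 : ℕ) : ℝ) := Nat.cast_nonneg _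
    linarith
  have hone : ∀ l, (classCount y l : ℝ)⁻¹ ≤ 2 / N * (prior l)⁻¹ := by
    intro l
    have hp : 0 < (N : ℝ) * prior l / 2 := by have := hprior l; positivity
    refine (inv_anti₀ hp (hy l)).trans (le_of_eq ?_)
    have := (hprior l).ne'
    field_simp
  have hpi := inv_add_inv_le_piBar hprior k
  have hpi0 : 0 ≤ piBar prior := by
    have := inv_pos.2 (hprior 0); have := inv_pos.2 (hprior k.succ); linarith
  calc _ ≤ 2 / N * ((prior 0)⁻¹ + (prior k.succ)⁻¹) := by
        rw [mul_add]; exact add_le_add (hone 0) (hone k.succ)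
    _ ≤ 2 / N * piBar prior := by gcongr
    _ = 2 * piBar prior / N := by ring
    _ ≤ _ := by
        apply div_le_div_of_nonneg_left (by positivity) hd
        have : (0 : ℝ) ≤ ((m + 1 : ℕ) : ℝ) := Nat.cast_nonneg _
        linarith

lemma rate_nonneg (N : ℕ) (prior : Fin (m + 1) → ℝ) (mu : Fin (m + 1) → EuclideanSpace ℝ (Fin p))
    (Sig : Matrix (Fin p) (Fin p) ℝ) (t v : ℝ) : 0 ≤ rate N prior mu Sig t v :=
  Real.sqrt_nonneg _

lemma sq_rate (hN : m + 1 < N) (hpi : 0 ≤ piBar prior) {t v : ℝ} (ht : 0 < t) (hv : 0 ≤ v) :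
    rate N prior mu Sig t v ^ 2 =
      piBar prior * v * max (totalDelta mu Sig) (m + 1 : ℕ) * t / ((N : ℝ) - (m + 1 : ℕ)) := by
  have hd : (0 : ℝ) < (N : ℝ) - (m + 1 : ℕ) := sub_pos.2 (by exact_mod_cast hN)
  have hmax : 0 ≤ max (totalDelta mu Sig) (m + 1 : ℕ) := le_max_of_le_right (Nat.cast_nonneg _)
  exact Real.sq_sqrt (by positivity)

lemma rate_le_rate_diagMax (hN : m + 1 < N) (hpi : 0 ≤ piBar prior) {t : ℝ} (ht : 0 < t)
    (j : Fin p) : rate N prior mu Sig t (Sig j j) ≤ rate N prior mu Sig t (diagMax Sig) := by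
  have hd : (0 : ℝ) < (N : ℝ) - (m + 1 : ℕ) := sub_pos.2 (by exact_mod_cast hN)
  have hmax : 0 ≤ max (totalDelta mu Sig) (m + 1 : ℕ) := le_max_of_le_right (Nat.cast_nonneg _)
  have hj : Sig j j ≤ diagMax Sig :=
    le_ciSup (f := fun j : Fin p => Sig j j) (Set.finite_range _).bddAbove j
  unfold rate
  gcongr

/-! ### Noise bounds -/

/-- The deviations of the estimated mean differences. -/
noncomputable def meanNoise (mu : Fin (m + 1) → EuclideanSpace ℝ (Fin p))
    (x : Fin N → EuclideanSpace ℝ (Fin p)) (y : Fin N → Fin (m + 1)) :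
    Matrix (Fin p) (Fin m) ℝ :=
  Matrix.of fun j k => meanDiffHat x y k j - meanDiff mu k j

/-- The deviations `(S - Σ) β_k`. -/
noncomputable def covNoise (mu : Fin (m + 1) → EuclideanSpace ℝ (Fin p))
    (Sig : Matrix (Fin p) (Fin p) ℝ)
    (x : Fin N → EuclideanSpace ℝ (Fin p)) (y : Fin N → Fin (m + 1)) :
    Matrix (Fin p) (Fin m) ℝ :=
  Matrix.of fun j k => (pooledCov x y *ᵥ (bayesDir mu Sig)ᵀ k) j - meanDiff mu k j

lemma gradient_bayesDir (x : Fin N → EuclideanSpace ℝ (Fin p)) (y : Fin N → Fin (m + 1)) :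
    gradient x y (bayesDir mu Sig) = covNoise mu Sig x y + -meanNoise mu x y := by
  ext j k
  simp [gradient, covNoise, meanNoise]

lemma gradient_zero (x : Fin N → EuclideanSpace ℝ (Fin p)) (y : Fin N → Fin (m + 1)) :
    gradient x y (0 : Matrix (Fin p) (Fin m) ℝ) =
      -(Matrix.of (fun j k => meanDiff mu k j) + meanNoise mu x y) := by
  ext j k
  have h0 : (pooledCov x y *ᵥ (0 : Matrix (Fin p) (Fin m) ℝ)ᵀ k) j = 0 := by
    rw [show (0 : Matrix (Fin p) (Fin m) ℝ)ᵀ k = 0 from rfl, mulVec_zero, Pi.zero_apply]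
  simp only [gradient, of_apply, h0]
  simp [meanNoise]

lemma rowNorm_meanNoise_le {x : Fin N → EuclideanSpace ℝ (Fin p)} {y : Fin N → Fin (m + 1)}
    (hN : m + 1 < N) (hprior : ∀ k, 0 < prior k) (hpi : 0 ≤ piBar prior) (hS : Sig.PosDef)
    (hy : ∀ k, (N : ℝ) * prior k / 2 ≤ classCount y k) {t : ℝ} (ht : 0 < t) (j : Fin p)
    (h : ∀ k, |meanDiffHat x y k j - meanDiff mu k j| ≤ √(6 * t) *
        √(Sig j j * ((classCount y 0 : ℝ)⁻¹ + (classCount y k.succ : ℝ)⁻¹))) :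
    rowNorm (meanNoise mu x y) j ≤ 4 * rate N prior mu Sig t (Sig j j) := by
  have hd : (0 : ℝ) < (N : ℝ) - (m + 1 : ℕ) := sub_pos.2 (by exact_mod_cast hN)
  have hv : 0 ≤ Sig j j := hS.posSemidef.diag_nonneg
  refine rowNorm_le_of_sum_sq_le (mul_nonneg (by norm_num) (rate_nonneg _ _ _ _ _ _)) ?_
  have hterm : ∀ k ∈ Finset.univ, meanNoise mu x y j k ^ 2 ≤
      12 * (piBar prior * Sig j j * t / ((N : ℝ) - (m + 1 : ℕ))) := by
    intro k _
    have h1 := pow_le_pow_left₀ (abs_nonneg _) (h k) 2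
    rw [sq_abs, mul_pow, Real.sq_sqrt (by positivity), Real.sq_sqrt (by positivity)] at h1
    refine h1.trans ?_
    calc _ ≤ 6 * t * (Sig j j * (2 * piBar prior / ((N : ℝ) - (m + 1 : ℕ)))) := by
          gcongr; exact inv_classCount_add_le hN hprior hy k
      _ = _ := by ring
  refine (Finset.sum_le_sum hterm).trans ?_
  rw [mul_pow, sq_rate hN hpi ht hv, Finset.sum_const, Finset.card_univ, Fintype.card_fin,
    nsmul_eq_mul]
  -- The `K'` columns are absorbed by the `K` in `Δ ∨ K`, and `12 ≤ 4²`.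
  have hm : (m : ℝ) ≤ max (totalDelta mu Sig) (m + 1 : ℕ) :=
    le_max_of_le_right (by push_cast; linarith)
  have hw : 0 ≤ piBar prior * Sig j j * t / ((N : ℝ) - (m + 1 : ℕ)) := by positivity
  have hm0 : (0 : ℝ) ≤ m := Nat.cast_nonneg _
  have e : piBar prior * Sig j j * max (totalDelta mu Sig) (m + 1 : ℕ) * t /
      ((N : ℝ) - (m + 1 : ℕ)) = max (totalDelta mu Sig) (m + 1 : ℕ) *
        (piBar prior * Sig j j * t / ((N : ℝ) - (m + 1 : ℕ))) := by ring
  rw [e]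
  nlinarith [mul_le_mul_of_nonneg_right hm hw, mul_nonneg hm0 hw]

lemma mul_totalDelta_le_sq_rate (hN : m + 1 < N) (hpi : 1 ≤ piBar prior) (hS : Sig.PosDef)
    {t : ℝ} (ht : 0 < t) (j : Fin p) :
    Sig j j * totalDelta mu Sig * t / ((N : ℝ) - (m + 1 : ℕ)) ≤
      rate N prior mu Sig t (Sig j j) ^ 2 := by
  have hd : (0 : ℝ) < (N : ℝ) - (m + 1 : ℕ) := sub_pos.2 (by exact_mod_cast hN)
  have hv : 0 ≤ Sig j j := hS.posSemidef.diag_nonneg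
  have hD : 0 ≤ totalDelta mu Sig := by
    rw [totalDelta_eq hS]; exact Finset.sum_nonneg fun k _ => bayesDir_variance_nonneg hS k
  rw [sq_rate hN (by linarith) ht hv]
  gcongr
  · exact le_mul_of_one_le_left hv hpi
  · exact le_max_left _ _

/-- The squared entry bounds are proportional to `β_k' Σ β_k`, and these sum over `k` to `Δ`. -/
lemma rowNorm_covNoise_le {x : Fin N → EuclideanSpace ℝ (Fin p)} {y : Fin N → Fin (m + 1)}
    (hN : m + 1 < N) (hpi : 1 ≤ piBar prior) (hS : Sig.PosDef)
    (hy : ∀ k, 0 < classCount y k) {t : ℝ} (ht : 0 < t) (j : Fin p)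
    (h : ∀ k, |(score mu y (Pi.single j 1) x).ofLp ⬝ᵥ withinProj y *ᵥ
          (score mu y ((bayesDir mu Sig)ᵀ k) x).ofLp -
        ((N : ℝ) - (m + 1 : ℕ)) * (Pi.single j 1 ⬝ᵥ Sig *ᵥ (bayesDir mu Sig)ᵀ k)| ≤
      25 / 2 * √(((N : ℝ) - (m + 1 : ℕ)) * t) *
        (√(Pi.single j 1 ⬝ᵥ Sig *ᵥ Pi.single j 1) *
          √((bayesDir mu Sig)ᵀ k ⬝ᵥ Sig *ᵥ (bayesDir mu Sig)ᵀ k))) :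
    rowNorm (covNoise mu Sig x y) j ≤ 25 / 2 * rate N prior mu Sig t (Sig j j) := by
  have hd : (0 : ℝ) < (N : ℝ) - (m + 1 : ℕ) := sub_pos.2 (by exact_mod_cast hN)
  have hv : 0 ≤ Sig j j := hS.posSemidef.diag_nonneg
  have hjj : Pi.single j 1 ⬝ᵥ Sig *ᵥ Pi.single j 1 = Sig j j := by simp
  refine rowNorm_le_of_sum_sq_le (mul_nonneg (by norm_num) (rate_nonneg _ _ _ _ _ _)) ?_
  set d : ℝ := (N : ℝ) - (m + 1 : ℕ) with hd_def
  have hterm : ∀ k ∈ Finset.univ, covNoise mu Sig x y j k ^ 2 ≤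
      (25 / 2) ^ 2 * (Sig j j * t / d) *
        ((bayesDir mu Sig)ᵀ k ⬝ᵥ Sig *ᵥ (bayesDir mu Sig)ᵀ k) := by
    intro k _
    have hb := bayesDir_variance_nonneg (mu := mu) hS k
    have h1 := pow_le_pow_left₀ (abs_nonneg _) (h k) 2
    rw [sq_abs, mul_pow, mul_pow, mul_pow, hjj, Real.sq_sqrt (by positivity), Real.sq_sqrt hv,
      Real.sq_sqrt hb, mulVec_bayesDir hS, single_dotProduct, one_mul] at h1
    rw [covNoise, of_apply, pooledCov_mulVec hy mu, ← hd_def]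
    set W := (score mu y (Pi.single j 1) x).ofLp ⬝ᵥ withinProj y *ᵥ
          (score mu y ((bayesDir mu Sig)ᵀ k) x).ofLp
    have e : (d⁻¹ * W - meanDiff mu k j) ^ 2 = (d⁻¹) ^ 2 * (W - d * meanDiff mu k j) ^ 2 := by
      field_simp
    rw [e]
    rw [← mulVec_bayesDir hS] at h1 ⊢
    refine (mul_le_mul_of_nonneg_left h1 (by positivity)).trans (le_of_eq ?_)
    field_simp
  refine (Finset.sum_le_sum hterm).trans ?_
  rw [← Finset.mul_sum, ← totalDelta_eq hS, mul_pow, mul_assoc]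
  gcongr
  refine le_trans (le_of_eq ?_) (mul_totalDelta_le_sq_rate hN hpi hS ht j)
  ring

/-- Here `t / (N - K) ≥ 1`, so the signal bound `Σ_jj Δ` is already at most the squared rate. -/
lemma rowNorm_meanDiff_le (hN : m + 1 < N) (hpi : 1 ≤ piBar prior) (hS : Sig.PosDef)
    {t : ℝ} (ht : (N : ℝ) - (m + 1 : ℕ) ≤ t) (j : Fin p) :
    rowNorm (Matrix.of fun j (k : Fin m) => meanDiff mu k j) j ≤
      rate N prior mu Sig t (Sig j j) := by
  have hd : (0 : ℝ) < (N : ℝ) - (m + 1 : ℕ) := sub_pos.2 (by exact_mod_cast hN)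
  refine rowNorm_le_of_sum_sq_le (rate_nonneg _ _ _ _ _ _) ?_
  refine (Finset.sum_le_sum fun k _ => meanDiff_sq_le hS k j).trans ?_
  rw [← Finset.mul_sum, ← totalDelta_eq hS]
  refine le_trans ?_ (mul_totalDelta_le_sq_rate hN hpi hS (hd.trans_le ht) j)
  have hD : 0 ≤ totalDelta mu Sig := by
    rw [totalDelta_eq hS]; exact Finset.sum_nonneg fun k _ => bayesDir_variance_nonneg hS k
  rw [le_div_iff₀ hd]
  have hv : 0 ≤ Sig j j := hS.posSemidef.diag_nonneg
  gcongr

end Population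

/-! ### The exceptional set -/

/-- The observations for which one of the noise bounds fails, given the labels `y`. -/
def badNoise (mu : Fin (m + 1) → EuclideanSpace ℝ (Fin p)) (Sig : Matrix (Fin p) (Fin p) ℝ)
    (t : ℝ) (y : Fin N → Fin (m + 1)) : Set (Fin N → EuclideanSpace ℝ (Fin p)) :=
  ⋃ jk : Fin p × Fin m,
    {x | √(6 * t) * √(Sig jk.1 jk.1 *
        ((classCount y 0 : ℝ)⁻¹ + (classCount y jk.2.succ : ℝ)⁻¹)) <
          |meanDiffHat x y jk.2 jk.1 - meanDiff mu jk.2 jk.1|} ∪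
    {x | t ≤ (N : ℝ) - (m + 1 : ℕ) ∧ 25 / 2 * √(((N : ℝ) - (m + 1 : ℕ)) * t) *
        (√(Pi.single jk.1 1 ⬝ᵥ Sig *ᵥ Pi.single jk.1 1) *
          √((bayesDir mu Sig)ᵀ jk.2 ⬝ᵥ Sig *ᵥ (bayesDir mu Sig)ᵀ jk.2)) <
      |(score mu y (Pi.single jk.1 1) x).ofLp ⬝ᵥ withinProj y *ᵥ
          (score mu y ((bayesDir mu Sig)ᵀ jk.2) x).ofLp -
        ((N : ℝ) - (m + 1 : ℕ)) * (Pi.single jk.1 1 ⬝ᵥ Sig *ᵥ (bayesDir mu Sig)ᵀ jk.2)|}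

variable {mu : Fin (m + 1) → EuclideanSpace ℝ (Fin p)} {Sig : Matrix (Fin p) (Fin p) ℝ} {t : ℝ}

lemma measurableSet_badNoise (y : Fin N → Fin (m + 1)) :
    MeasurableSet (badNoise mu Sig t y) := by
  refine MeasurableSet.iUnion fun jk => MeasurableSet.union ?_ ?_
  · have : Measurable fun x : Fin N → EuclideanSpace ℝ (Fin p) => meanDiffHat x y jk.2 jk.1 := by
      unfold meanDiffHat classMean; fun_prop
    apply measurableSet_lt <;> fun_prop
  · have hs := fun v => measurable_score mu y v
    have : Measurable fun x : Fin N → EuclideanSpace ℝ (Fin p) =>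
        (score mu y (Pi.single jk.1 1) x).ofLp ⬝ᵥ withinProj y *ᵥ
          (score mu y ((bayesDir mu Sig)ᵀ jk.2) x).ofLp := by
      have h1 := hs (Pi.single jk.1 1)
      have h2 := hs ((bayesDir mu Sig)ᵀ jk.2)
      unfold dotProduct mulVec dotProduct
      fun_prop
    exact (MeasurableSet.const _).inter
      (measurableSet_lt measurable_const (this.sub_const _).abs)

lemma designLaw_badNoise_le (hS : Sig.PosDef) {y : Fin N → Fin (m + 1)}
    (hy : ∀ k, 0 < classCount y k) (ht : 0 < t) :
    (designLaw mu Sig y).real (badNoise mu Sig t y) ≤ p * m * (6 * Real.exp (-3 * t)) := by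
  refine (measureReal_iUnion_fintype_le _).trans ?_
  have hterm : ∀ jk : Fin p × Fin m, (designLaw mu Sig y).real
      ({x | √(6 * t) * √(Sig jk.1 jk.1 *
        ((classCount y 0 : ℝ)⁻¹ + (classCount y jk.2.succ : ℝ)⁻¹)) <
          |meanDiffHat x y jk.2 jk.1 - meanDiff mu jk.2 jk.1|} ∪
      {x | t ≤ (N : ℝ) - (m + 1 : ℕ) ∧ 25 / 2 * √(((N : ℝ) - (m + 1 : ℕ)) * t) *
        (√(Pi.single jk.1 1 ⬝ᵥ Sig *ᵥ Pi.single jk.1 1) *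
          √((bayesDir mu Sig)ᵀ jk.2 ⬝ᵥ Sig *ᵥ (bayesDir mu Sig)ᵀ jk.2)) <
      |(score mu y (Pi.single jk.1 1) x).ofLp ⬝ᵥ withinProj y *ᵥ
          (score mu y ((bayesDir mu Sig)ᵀ jk.2) x).ofLp -
        ((N : ℝ) - (m + 1 : ℕ)) * (Pi.single jk.1 1 ⬝ᵥ Sig *ᵥ (bayesDir mu Sig)ᵀ jk.2)|}) ≤
      6 * Real.exp (-3 * t) := by
    intro jk
    have h1 := mean_noise_tail (mu := mu) hS.posSemidef hy jk.1 jk.2 ht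
    refine (measureReal_union_le _ _).trans ((add_le_add h1 (?_ : _ ≤ 4 * Real.exp (-3 * t))).trans
      (by linarith))
    -- For larger `t` the covariance event is empty by its first conjunct.
    by_cases htd : t ≤ (N : ℝ) - (m + 1 : ℕ)
    · simp only [htd, true_and]
      exact cross_score_tail hS hy _ _ ht htd
    · simp only [htd, false_and]
      simp [Real.exp_nonneg]
  refine (Finset.sum_le_sum fun jk _ => hterm jk).trans (le_of_eq ?_)
  simp [mul_assoc]

lemma noise_bounds_of_notMem_badNoise {x : Fin N → EuclideanSpace ℝ (Fin p)}
    {y : Fin N → Fin (m + 1)} (h : x ∉ badNoise mu Sig t y) (j : Fin p) (k : Fin m) :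
    |meanDiffHat x y k j - meanDiff mu k j| ≤ √(6 * t) *
        √(Sig j j * ((classCount y 0 : ℝ)⁻¹ + (classCount y k.succ : ℝ)⁻¹)) ∧
    (t ≤ (N : ℝ) - (m + 1 : ℕ) → |(score mu y (Pi.single j 1) x).ofLp ⬝ᵥ withinProj y *ᵥ
          (score mu y ((bayesDir mu Sig)ᵀ k) x).ofLp -
        ((N : ℝ) - (m + 1 : ℕ)) * (Pi.single j 1 ⬝ᵥ Sig *ᵥ (bayesDir mu Sig)ᵀ k)| ≤
      25 / 2 * √(((N : ℝ) - (m + 1 : ℕ)) * t) *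
        (√(Pi.single j 1 ⬝ᵥ Sig *ᵥ Pi.single j 1) *
          √((bayesDir mu Sig)ᵀ k ⬝ᵥ Sig *ᵥ (bayesDir mu Sig)ᵀ k))) := by
  simp only [badNoise, Set.mem_iUnion, not_exists] at h
  have h' := h (j, k)
  rw [Set.mem_union, not_or] at h'
  exact ⟨not_lt.1 h'.1, fun htd => not_lt.1 fun hc => h'.2 ⟨htd, hc⟩⟩

/-- The failure probability is within the budget of the oracle bound. -/
lemma failure_le_budget {δ : ℝ} (hm : 1 ≤ m) (ht : 0 < t) (h1 : δ ≤ 1)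
    (h2 : δ ≤ p * m * (6 * Real.exp (-3 * t))) :
    δ ≤ ((m + 1 : ℕ) : ℝ) * p * Real.exp (-t) +
      2 * ((m + 1 : ℕ) : ℝ) * p / (√Real.pi * t) * Real.exp (-t ^ 2) := by
  have hsecond : 0 ≤ 2 * ((m + 1 : ℕ) : ℝ) * p / (√Real.pi * t) * Real.exp (-t ^ 2) := by
    positivity
  have hm' : (1 : ℝ) ≤ m := by exact_mod_cast hm
  have hexp1 : (2.7 : ℝ) < Real.exp 1 := by linarith [Real.exp_one_gt_d9]
  -- For `t ≥ 1` the first budget term suffices, since `6 e^{-2t} ≤ 1`. For `t ≤ 1` and `p ≥ 1` each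
  -- of the two terms is at least `2/3`, so the budget exceeds one.
  rcases le_total 1 t with h | h
  · have h3 : 6 * Real.exp (-3 * t) ≤ Real.exp (-t) := by
      have e : Real.exp (-3 * t) = Real.exp (-t) * Real.exp (-(2 * t)) := by
        rw [← Real.exp_add]; congr 1; ring
      have h4 : Real.exp (-(2 * t)) ≤ 1 / 6 := by
        rw [Real.exp_neg, one_div]
        apply inv_anti₀ (by norm_num)
        have h5 : Real.exp 1 * Real.exp 1 ≤ Real.exp (2 * t) := by
          rw [← Real.exp_add]; exact Real.exp_le_exp.2 (by linarith)
        nlinarith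
      rw [e]
      nlinarith [Real.exp_pos (-t)]
    have h6 : (p : ℝ) * m * (6 * Real.exp (-3 * t)) ≤ ((m + 1 : ℕ) : ℝ) * p * Real.exp (-t) := by
      rw [mul_comm (p : ℝ)]
      push_cast
      gcongr
      linarith
    linarith
  · rcases Nat.eq_zero_or_pos p with rfl | hp
    · simpa using h2
    have hp' : (1 : ℝ) ≤ p := by exact_mod_cast hp
    have hKp : (2 : ℝ) ≤ ((m + 1 : ℕ) : ℝ) * p := by push_cast; nlinarith
    have he : Real.exp (-1) ≤ Real.exp (-t) := Real.exp_le_exp.2 (by linarith)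
    have he' : Real.exp (-1) ≤ Real.exp (-t ^ 2) := Real.exp_le_exp.2 (by nlinarith)
    have he1 : (1 / 3 : ℝ) ≤ Real.exp (-1) := by
      rw [Real.exp_neg, one_div]
      exact inv_anti₀ (Real.exp_pos _) (by linarith [Real.exp_one_lt_d9])
    have hsp : √Real.pi * t ≤ 2 := by
      have : √Real.pi ≤ 2 := Real.sqrt_le_iff.2 ⟨by norm_num, by linarith [Real.pi_le_four]⟩
      nlinarith
    have hq : ((m + 1 : ℕ) : ℝ) * p ≤ 2 * ((m + 1 : ℕ) : ℝ) * p / (√Real.pi * t) := by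
      rw [le_div_iff₀ (by positivity)]
      nlinarith
    have g1 : 2 * (1 / 3 : ℝ) ≤ ((m + 1 : ℕ) : ℝ) * p * Real.exp (-t) :=
      mul_le_mul hKp (he1.trans he) (by norm_num) (by positivity)
    have g2 : 2 * (1 / 3 : ℝ) ≤
        2 * ((m + 1 : ℕ) : ℝ) * p / (√Real.pi * t) * Real.exp (-t ^ 2) :=
      mul_le_mul (hKp.trans hq) (he1.trans he') (by norm_num) (by positivity)
    linarith

/-! ### Deterministic consequences outside the exceptional set, for small and for large `t` -/

section Oracle

variable {prior : Fin (m + 1) → ℝ} {x : Fin N → EuclideanSpace ℝ (Fin p)}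
  {y : Fin N → Fin (m + 1)} {lam : Fin p → ℝ} {bh : Matrix (Fin p) (Fin m) ℝ}

lemma classCount_pos_of_balanced (hN : m + 1 < N) (hprior : ∀ k, 0 < prior k)
    (hy : ∀ k, (N : ℝ) * prior k / 2 ≤ classCount y k) (k : Fin (m + 1)) :
    0 < classCount y k := by
  have hN0 : (0 : ℝ) < N := by exact_mod_cast (Nat.zero_lt_of_lt hN)
  have := hprior k
  have h : (0 : ℝ) < classCount y k := lt_of_lt_of_le (by positivity) (hy k)
  exact_mod_cast h

lemma rowNorm_gradient_bayesDir_le (hN : m + 1 < N) (hprior : ∀ k, 0 < prior k)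
    (hpi : 1 ≤ piBar prior) (hS : Sig.PosDef)
    (hy : ∀ k, (N : ℝ) * prior k / 2 ≤ classCount y k) (ht : 0 < t)
    (htd : t ≤ (N : ℝ) - (m + 1 : ℕ)) (hx : x ∉ badNoise mu Sig t y) (j : Fin p) :
    rowNorm (gradient x y (bayesDir mu Sig)) j ≤ 20 * rate N prior mu Sig t (Sig j j) := by
  have h1 := rowNorm_meanNoise_le hN hprior (by linarith) hS hy ht j
    fun k => (noise_bounds_of_notMem_badNoise hx j k).1
  have h2 := rowNorm_covNoise_le hN hpi hS (classCount_pos_of_balanced hN hprior hy) ht j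
    fun k => (noise_bounds_of_notMem_badNoise hx j k).2 htd
  rw [gradient_bayesDir]
  have h3 := rowNorm_add_le (covNoise mu Sig x y) (-meanNoise mu x y) j
  rw [rowNorm_neg] at h3
  have := rate_nonneg N prior mu Sig t (Sig j j)
  linarith

lemma rowNorm_gradient_zero_le (hN : m + 1 < N) (hprior : ∀ k, 0 < prior k)
    (hpi : 1 ≤ piBar prior) (hS : Sig.PosDef)
    (hy : ∀ k, (N : ℝ) * prior k / 2 ≤ classCount y k) (ht : 0 < t)
    (htd : (N : ℝ) - (m + 1 : ℕ) ≤ t) (hx : x ∉ badNoise mu Sig t y) (j : Fin p) :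
    rowNorm (gradient x y (0 : Matrix (Fin p) (Fin m) ℝ)) j ≤
      5 * rate N prior mu Sig t (Sig j j) := by
  have h1 := rowNorm_meanNoise_le hN hprior (by linarith) hS hy ht j
    fun k => (noise_bounds_of_notMem_badNoise hx j k).1
  have h2 := rowNorm_meanDiff_le (mu := mu) hN hpi hS htd j
  rw [gradient_zero (mu := mu), rowNorm_neg]
  have h3 := rowNorm_add_le (Matrix.of fun j (k : Fin m) => meanDiff mu k j) (meanNoise mu x y) j
  linarith

lemma oracle_of_small (hN : m + 1 < N) (hprior : ∀ k, 0 < prior k)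
    (hpi : 1 ≤ piBar prior) (hS : Sig.PosDef)
    (hy : ∀ k, (N : ℝ) * prior k / 2 ≤ classCount y k) (ht : 0 < t)
    (htd : t ≤ (N : ℝ) - (m + 1 : ℕ)) (hx : x ∉ badNoise mu Sig t y)
    (hb : IsEstimator x y lam bh) :
    ∑ j, lam j * rowNorm bh j ≤ ∑ j, lam j * rowNorm (bayesDir mu Sig) j +
      20 * ∑ j, rowNorm (bh - bayesDir mu Sig) j * rate N prior mu Sig t (Sig j j) := by
  refine (basic_inequality (classCount_pos_of_balanced hN hprior hy) hN hb
    (bayesDir mu Sig)).trans ?_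
  rw [Finset.mul_sum]
  refine add_le_add le_rfl (Finset.sum_le_sum fun j _ => ?_)
  have h := rowNorm_gradient_bayesDir_le hN hprior hpi hS hy ht htd hx j
  have := mul_le_mul_of_nonneg_right h (rowNorm_nonneg (bh - bayesDir mu Sig) j)
  linarith

lemma rowNorm_eq_zero_of_large (hN : m + 1 < N) (hprior : ∀ k, 0 < prior k)
    (hpi : 1 ≤ piBar prior) (hS : Sig.PosDef)
    (hy : ∀ k, (N : ℝ) * prior k / 2 ≤ classCount y k) (ht : 0 < t)
    (htd : (N : ℝ) - (m + 1 : ℕ) ≤ t) (hx : x ∉ badNoise mu Sig t y)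
    (hlam : ∀ j, 0 < lam j)
    (hl : ∀ j, lam j = 2 * 20 * rate N prior mu Sig t (diagMax Sig))
    (hb : IsEstimator x y lam bh) (j : Fin p) : rowNorm bh j = 0 := by
  refine rowNorm_eq_zero_of_large_penalty (classCount_pos_of_balanced hN hprior hy) hN hb
    (fun i => ?_) j
  -- The gradient at `0` is at most `5` rates against a penalty of `40`; strictness comes from `lam
  -- i > 0`, which forces the rate to be positive.
  have h1 := rowNorm_gradient_zero_le hN hprior hpi hS hy ht htd hx i
  have h2 := rate_le_rate_diagMax (mu := mu) (Sig := Sig) hN (by linarith : 0 ≤ piBar prior) ht i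
  have h3 := hlam i
  have h4 := hl i
  linarith

end Oracle

end SparseLDA

theorem proposition1 :
    ∃ C₀ : ℝ, 0 < C₀ ∧
      ∀ (Ω : Type*) [MeasurableSpace Ω] (P : Measure Ω) [IsProbabilityMeasure P]
        (p m N : ℕ) (_hm : 1 ≤ m) (_hN : m + 1 < N)
        (X : Fin N → Ω → EuclideanSpace ℝ (Fin p)) (Y : Fin N → Ω → Fin (m + 1))
        (prior : Fin (m + 1) → ℝ) (mu : Fin (m + 1) → EuclideanSpace ℝ (Fin p))
        (Sig : Matrix (Fin p) (Fin p) ℝ)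
        (_hprior : ∀ k, 0 < prior k) (_hSig : Sig.PosDef)
        (_hsample : SparseLDA.IsLDASample P X Y prior mu Sig)
        (t : ℝ) (_ht : 0 < t),
        ∃ B : Set Ω, MeasurableSet B ∧
          P.real B ≥ P.real (SparseLDA.balancedEvent Y prior)
            - ((m + 1 : ℕ) : ℝ) * p * Real.exp (-t)
            - 2 * ((m + 1 : ℕ) : ℝ) * p / (Real.sqrt Real.pi * t) * Real.exp (-t ^ 2) ∧
          ∀ ω ∈ B,
            -- every class is observed, so that the class means are genuine
            (∀ k, 0 < SparseLDA.classCount (fun i => Y i ω) k) ∧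
            ∀ (lam : Fin p → ℝ) (_hlam : ∀ j, 0 < lam j) (βhat : Matrix (Fin p) (Fin m) ℝ)
              (_hβ : SparseLDA.IsEstimator (fun i => X i ω) (fun i => Y i ω) lam βhat),
              ((t ≤ (N : ℝ) - (m + 1 : ℕ) ∨
                  ∀ j, lam j = 2 * C₀ * SparseLDA.rate N prior mu Sig t (SparseLDA.diagMax Sig)) →
                ∑ j, lam j * SparseLDA.rowNorm βhat j ≤
                  ∑ j, lam j * SparseLDA.rowNorm (SparseLDA.bayesDir mu Sig) j
                    + C₀ * ∑ j, SparseLDA.rowNorm (βhat - SparseLDA.bayesDir mu Sig) j *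
                        SparseLDA.rate N prior mu Sig t (Sig j j)) ∧
              ((∀ j, lam j = 2 * C₀ * SparseLDA.rate N prior mu Sig t (SparseLDA.diagMax Sig)) →
                ∑ j ∈ (SparseLDA.jointSupport (SparseLDA.bayesDir mu Sig))ᶜ,
                    SparseLDA.rowNorm βhat j ≤
                  3 * ∑ j ∈ SparseLDA.jointSupport (SparseLDA.bayesDir mu Sig),
                    SparseLDA.rowNorm (βhat - SparseLDA.bayesDir mu Sig) j) := by
  -- The constant `20` leaves room above `4 + 25/2`, the sum of the mean and covariance noise
  -- constants.
  open SparseLDA in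
  refine ⟨20, by norm_num, ?_⟩
  intro Ω _ P _ p m N hm hN X Y prior mu Sig hprior hS hsample t ht
  set A : Set (Fin N → Fin (m + 1)) := {y | ∀ k, (classCount y k : ℝ) ∈
    Set.Icc ((N : ℝ) * prior k / 2) (3 * (N : ℝ) * prior k / 2)} with hA
  have hAy : ∀ y ∈ A, ∀ k, (N : ℝ) * prior k / 2 ≤ classCount y k := fun y hy k => (hy k).1
  have hprior_one : prior 0 ≤ 1 := by
    rw [← hsample.label_law ⟨0, by omega⟩ 0]; exact measureReal_le_one
  have hpi := one_le_piBar hm hprior hprior_one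
  refine ⟨{ω | (fun i => Y i ω) ∈ A ∧ (fun i => X i ω) ∈ (badNoise mu Sig t fun i => Y i ω)ᶜ},
    measurableSet_labels_observations hsample A (D := fun y => (badNoise mu Sig t y)ᶜ)
      fun y => (measurableSet_badNoise y).compl, ?_, ?_⟩
  · have hbad : P.real {ω | (fun i => Y i ω) ∈ A ∧
        (fun i => X i ω) ∈ badNoise mu Sig t fun i => Y i ω} ≤ p * m * (6 * Real.exp (-3 * t)) :=
      prob_of_designLaw_le hsample A measurableSet_badNoise (by positivity) fun y hy =>
        designLaw_badNoise_le hS (classCount_pos_of_balanced hN hprior (hAy y hy)) ht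
    have hbudget := failure_le_budget hm ht measureReal_le_one hbad
    have hcover : balancedEvent Y prior ⊆
        {ω | (fun i => Y i ω) ∈ A ∧ (fun i => X i ω) ∈ (badNoise mu Sig t fun i => Y i ω)ᶜ} ∪
        {ω | (fun i => Y i ω) ∈ A ∧ (fun i => X i ω) ∈ badNoise mu Sig t fun i => Y i ω} := by
      intro ω hω
      by_cases h : (fun i => X i ω) ∈ badNoise mu Sig t fun i => Y i ω
      · exact Or.inr ⟨hω, h⟩
      · exact Or.inl ⟨hω, h⟩
    have := (measureReal_mono hcover (measure_ne_top P _)).trans (measureReal_union_le _ _)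
    linarith
  · rintro ω ⟨hωA, hωX⟩
    have hy := hAy _ hωA
    refine ⟨classCount_pos_of_balanced hN hprior hy, fun lam hlam bh hb => ?_⟩
    by_cases htd : t ≤ (N : ℝ) - (m + 1 : ℕ)
    · have hor := oracle_of_small hN hprior hpi hS hy ht htd hωX hb
      refine ⟨fun _ => hor, fun hl => ?_⟩
      -- The positivity of `λ*` is read off from a coordinate, so `p = 0` is treated apart.
      rcases isEmpty_or_nonempty (Fin p) with hp | ⟨⟨j₀⟩⟩
      · simp [Finset.eq_empty_of_isEmpty]
      refine cone_condition (lam := 2 * 20 * rate N prior mu Sig t (diagMax Sig))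
        (by rw [← hl j₀]; exact hlam j₀) ?_
      -- Raising every `Σ_jj` to the maximum makes the noise level exactly `λ* / 2`, as the cone
      -- condition requires.
      simp only [hl] at hor
      refine hor.trans ?_
      rw [Finset.mul_sum]
      refine add_le_add le_rfl (Finset.sum_le_sum fun j _ => ?_)
      have h1 := rate_le_rate_diagMax (mu := mu) (Sig := Sig) hN
        (by linarith : 0 ≤ piBar prior) ht j
      have h2 := mul_le_mul_of_nonneg_left h1 (rowNorm_nonneg (bh - bayesDir mu Sig) j)
      linarith
    · have hzero := fun hl => rowNorm_eq_zero_of_large hN hprior hpi hS hy ht (not_le.1 htd).le hωX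
        hlam hl hb
      refine ⟨fun h => ?_, fun hl => ?_⟩
      · simp only [hzero (h.resolve_left htd), mul_zero, Finset.sum_const_zero]
        have h1 : 0 ≤ ∑ j, lam j * rowNorm (bayesDir mu Sig) j :=
          Finset.sum_nonneg fun j _ => mul_nonneg (hlam j).le (rowNorm_nonneg _ _)
        have h2 : 0 ≤ ∑ j, rowNorm (bh - bayesDir mu Sig) j * rate N prior mu Sig t (Sig j j) :=
          Finset.sum_nonneg fun j _ => mul_nonneg (rowNorm_nonneg _ _) (rate_nonneg _ _ _ _ _ _)
        linarith
      · simp only [hzero hl, Finset.sum_const_zero]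
        exact mul_nonneg (by norm_num) (Finset.sum_nonneg fun j _ => rowNorm_nonneg _ _)
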